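/- Let $Z_1, Z_2, \ldots$ be independent, identically distributed random vectors in $\mathbb{R}^2$ with $\mathbb{E}\|Z_1\|^2 < \infty$ and $\mathbb{E} Z_1 \neq 0$, where $\|\cdot\|$ is the Euclidean norm. Put $S_0 = 0$ and $S_n = Z_1 + \cdots + Z_n$ for $n \ge 1$, and let $L_n$ be the perimeter length of the convex hull of $\{S_0, S_1, \ldots, S_n\}$, with the usual convention that the perimeter length of a line segment is twice its length (and that of a point is $0$). Then $\mathbb{E}[L_n^2] < \infty$ for every $n$, and \[ \lim_{n \to \infty} \frac{1}{n} \operatorname{Var}[L_n] = \sigma^2 := \frac{4\, \mathbb{E}\big[ \big( (Z_1 - \mathbb{E} Z_1) \cdot \mathbb{E} Z_1 \big)^2 \big]}{\|\mathbb{E} Z_1\|^2} \in [0, \infty). \] Moreover, $\sigma^2 = 0$ if and only if $(Z_1 - \mathbb{E} Z_1) \cdot \mathbb{E} Z_1 = 0$ with probability $1$. -/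

import Mathlib

open MeasureTheory ProbabilityTheory Filter Topology

namespace PlanarWalk

/-- The Euclidean plane. -/
abbrev Plane : Type := EuclideanSpace ℝ (Fin 2)

/-- The random walk `S₀ = 0`, `Sₙ = Z₁ + ⋯ + Zₙ`. The sequence of increments is indexed from `0`,
so that `Z i` is the increment of step number `i + 1`. -/
def walk {Ω : Type*} (Z : ℕ → Ω → Plane) (n : ℕ) (ω : Ω) : Plane :=
  ∑ i ∈ Finset.range n, Z i ω

/-- The convex hull of the positions `S₀, …, Sₙ`. -/
def hull {Ω : Type*} (Z : ℕ → Ω → Plane) (n : ℕ) (ω : Ω) : Set Plane :=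
  convexHull ℝ ((fun j : ℕ => walk Z j ω) '' Set.Iic n)

open Classical in
/-- The perimeter length of a compact convex set in the plane: the length (one-dimensional Hausdorff
measure) of its boundary. If the set has no interior, it is a line segment (or a point); the
boundary is then the segment run through once in each direction, so its length counts twice, which
is the usual convention of convex geometry and the one for which Cauchy's formula holds. -/
noncomputable def perimeter (K : Set Plane) : ℝ :=
  if (interior K).Nonempty then (Measure.hausdorffMeasure 1 (frontier K)).toReal
  else 2 * (Measure.hausdorffMeasure 1 (frontier K)).toReal

/-- `Lₙ`, the perimeter length of the convex hull of `S₀, …, Sₙ`. -/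
noncomputable def perim {Ω : Type*} (Z : ℕ → Ω → Plane) (n : ℕ) (ω : Ω) : ℝ :=
  perimeter (hull Z n ω)

/-- `(X - 𝔼 X) · 𝔼 X`, for a random vector `X`. -/
noncomputable def driftComponent {Ω : Type*} [MeasurableSpace Ω] (P : Measure Ω) (X : Ω → Plane)
    (ω : Ω) : ℝ :=
  inner ℝ (X ω - ∫ ω', X ω' ∂P) (∫ ω', X ω' ∂P)

/-- `σ² = 4 𝔼[((X - 𝔼 X) · 𝔼 X)²] / ‖𝔼 X‖²`. -/
noncomputable def sigmaSq {Ω : Type*} [MeasurableSpace Ω] (P : Measure Ω) (X : Ω → Plane) : ℝ :=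
  4 * (∫ ω, driftComponent P X ω ^ 2 ∂P) / ‖∫ ω, X ω ∂P‖ ^ 2

end PlanarWalk

/-! By Cauchy's formula the perimeter is the integral, over a half circle of directions `u`, of the
length of the projection of the hull to `u`. That length is `max u·Sⱼ - min u·Sⱼ`, which equals
`u·Sₙ` plus a nonnegative `excess`: the overshoot of the maximum above the final value and of the
minimum below the initial value `0`. If the half circle is centred at the direction `e` of the
drift, integrating `u·Sₙ` gives exactly `2 e·Sₙ` (`perim_eq`). Thus `Lₙ = 2 e·Sₙ + Dₙ`, where the
first term is an i.i.d. sum of variance exactly `n σ²`, and it remains to show that `𝔼[Dₙ²] = o(n)`;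
Cauchy–Schwarz then disposes of the covariance.

Each overshoot is a Lindley (reflected walk) value with increments `-u·Zᵢ`, in original or reversed
order. For `u` in the open half circle these increments have negative mean. Bounded increments of
negative mean give Lindley values with uniformly bounded exponential moments; a centred remainder of
small variance gives second moments growing at a small linear rate. Truncation and subadditivity of
the recursion combine the two into the bound `C + ε n` for every `ε > 0`
(`exists_integral_lindley_sq_le`). Dominated convergence over the directions, with a linear bound
valid whenever the drift is nonnegative, then gives `𝔼[Dₙ²] = o(n)`.

Cauchy's formula is proved for polygons by counting: almost every line orthogonal to `u` that meets
a polygon with interior meets its boundary exactly twice. -/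

namespace PlanarWalk

/-! ### Directions in the plane and integrals over half circles -/

/-- The unit vector with polar angle `θ`. -/
noncomputable def dir (θ : ℝ) : Plane := !₂[Real.cos θ, Real.sin θ]

/-- Rotation by a right angle. -/
noncomputable def rot (u : Plane) : Plane := !₂[-u 1, u 0]

theorem inner_eq (x y : Plane) : inner ℝ x y = x 0 * y 0 + x 1 * y 1 := by
  simp [PiLp.inner_apply, Fin.sum_univ_two, mul_comm]

theorem inner_dir (θ : ℝ) (x : Plane) :
    inner ℝ (dir θ) x = Real.cos θ * x 0 + Real.sin θ * x 1 := by
  simp [inner_eq, dir]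

theorem dir_ne_zero (θ : ℝ) : dir θ ≠ 0 := by
  intro h
  have h0 : Real.cos θ = 0 := by simpa [dir] using congrArg (fun v : Plane => v 0) h
  have h1 : Real.sin θ = 0 := by simpa [dir] using congrArg (fun v : Plane => v 1) h
  have := Real.sin_sq_add_cos_sq θ
  simp [h0, h1] at this

theorem norm_dir (θ : ℝ) : ‖dir θ‖ = 1 := by
  simp [dir, EuclideanSpace.norm_eq, Fin.sum_univ_two]

theorem exists_eq_norm_smul_dir (v : Plane) : ∃ φ, v = ‖v‖ • dir φ := by
  refine ⟨Complex.arg ⟨v 0, v 1⟩, ?_⟩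
  have hn : ‖(⟨v 0, v 1⟩ : ℂ)‖ = ‖v‖ := by
    rw [Complex.norm_eq_sqrt_sq_add_sq, EuclideanSpace.norm_eq]
    simp [Fin.sum_univ_two]
  ext i
  fin_cases i
  · simp [dir, ← hn, Complex.norm_mul_cos_arg]
  · simp [dir, ← hn, Complex.norm_mul_sin_arg]

theorem inner_dir_smul_dir (θ φ r : ℝ) :
    inner ℝ (dir θ) (r • dir φ) = r * Real.cos (θ - φ) := by
  rw [inner_dir, Real.cos_sub]
  simp [dir]
  ring

theorem integral_cos_pi (φ : ℝ) :
    ∫ θ in (φ - Real.pi / 2)..(φ + Real.pi / 2), Real.cos (θ - φ) = 2 := by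
  rw [intervalIntegral.integral_comp_sub_right (fun x => Real.cos x) φ]
  have e1 : φ - Real.pi / 2 - φ = -(Real.pi / 2) := by ring
  have e2 : φ + Real.pi / 2 - φ = Real.pi / 2 := by ring
  rw [e1, e2, integral_cos, Real.sin_neg, Real.sin_pi_div_two]
  norm_num

theorem continuous_inner_dir (v : Plane) : Continuous fun θ => inner ℝ (dir θ) v := by
  simp_rw [inner_dir]
  fun_prop

/-- The integrand has period `π`, so the window may be recentred at the direction of `v`, where the
cosine is nonnegative. This is Cauchy's formula for a single segment. -/
theorem integral_abs_inner_dir (φ : ℝ) (v : Plane) :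
    ∫ θ in (φ - Real.pi / 2)..(φ + Real.pi / 2), |inner ℝ (dir θ) v| = 2 * ‖v‖ := by
  obtain ⟨ψ, hψ⟩ := exists_eq_norm_smul_dir v
  have hper : Function.Periodic (fun θ => |inner ℝ (dir θ) v|) Real.pi := by
    intro θ
    simp only [inner_dir, Real.cos_add_pi, Real.sin_add_pi]
    rw [← abs_neg]
    ring_nf
  have e1 : ∀ φ : ℝ, φ + Real.pi / 2 = φ - Real.pi / 2 + Real.pi := fun φ => by ring
  rw [e1, hper.intervalIntegral_add_eq _ (ψ - Real.pi / 2), ← e1]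
  have : ∀ θ ∈ Set.uIcc (ψ - Real.pi / 2) (ψ + Real.pi / 2),
      |inner ℝ (dir θ) v| = ‖v‖ * Real.cos (θ - ψ) := by
    intro θ hθ
    rw [Set.uIcc_of_le (by linarith [Real.pi_pos])] at hθ
    have hc : 0 ≤ Real.cos (θ - ψ) :=
      Real.cos_nonneg_of_mem_Icc ⟨by linarith [hθ.1], by linarith [hθ.2]⟩
    conv_lhs => rw [hψ, inner_dir_smul_dir]
    rw [abs_of_nonneg (by positivity)]
  rw [intervalIntegral.integral_congr this, intervalIntegral.integral_const_mul, integral_cos_pi]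
  ring

/-! ### Lines through convex bodies and faces of polygons -/

/-- Points on a common line orthogonal to `u` differ by a multiple of `rot u`. -/
theorem exists_eq_add_smul_rot {u x y : Plane} (hu : u ≠ 0) (h : inner ℝ u x = inner ℝ u y) :
    ∃ s : ℝ, y = x + s • rot u := by
  have hu' : u 0 ^ 2 + u 1 ^ 2 ≠ 0 := by
    rw [sq, sq, ← inner_eq]
    simpa using hu
  refine ⟨inner ℝ (rot u) (y - x) / (u 0 ^ 2 + u 1 ^ 2), ?_⟩
  rw [inner_eq, inner_eq] at h
  ext i
  fin_cases i
  · simp [rot, inner_eq]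
    field_simp
    linear_combination (-u 0) * h
  · simp [rot, inner_eq]
    field_simp
    linear_combination (-u 1) * h

theorem inner_rot (u : Plane) : inner ℝ u (rot u) = 0 := by
  rw [inner_eq]
  simp [rot]
  ring

theorem rot_ne_zero {u : Plane} (hu : u ≠ 0) : rot u ≠ 0 := by
  intro h
  apply hu
  have h0 : u 1 = 0 := by simpa [rot] using congrArg (fun v : Plane => v 0) h
  have h1 : u 0 = 0 := by simpa [rot] using congrArg (fun v : Plane => v 1) h
  ext i
  fin_cases i <;> simp [h0, h1]

/-- A line through the interior of a convex body meets its boundary in two points. -/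
theorem exists_frontier_inter_line_eq_pair {K : Set Plane} (hK : IsCompact K)
    (hconv : Convex ℝ K) {u z : Plane} (hu : u ≠ 0) (hz : z ∈ interior K) :
    ∃ a b : Plane, a ≠ b ∧ {x ∈ frontier K | inner ℝ u x = inner ℝ u z} = {a, b} := by
  set w := rot u with hw
  have hw0 : w ≠ 0 := rot_ne_zero hu
  set g : ℝ → Plane := fun s => z + s • w with hg
  have hgc : Continuous g := by fun_prop
  have hgi : Function.Injective g := by
    intro s t hst
    simpa [hg, hw0] using hst
  have hcoer : Tendsto (fun s => ‖g s‖) (cocompact ℝ) atTop := by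
    have h1 : Tendsto (fun s : ℝ => ‖s‖ * ‖w‖ - ‖z‖) (cocompact ℝ) atTop :=
      tendsto_atTop_add_const_right _ _
        ((tendsto_norm_cocompact_atTop (E := ℝ)).atTop_mul_const (norm_pos_iff.2 hw0))
    refine tendsto_atTop_mono (fun s => ?_) h1
    have := norm_sub_norm_le (s • w) (-z)
    rw [norm_smul, norm_neg, sub_neg_eq_add, add_comm (s • w)] at this
    exact this
  set J := g ⁻¹' K with hJ
  have hJc : IsCompact J := by
    refine Metric.isCompact_of_isClosed_isBounded (hK.isClosed.preimage hgc) ?_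
    obtain ⟨C, hC⟩ := hK.isBounded.exists_norm_le
    have hb : ∀ s ∈ J, ‖s‖ ≤ (C + ‖z‖) / ‖w‖ := by
      intro s hs
      have h1 := hC _ hs
      have := norm_sub_norm_le (s • w) (-z)
      rw [norm_smul, norm_neg, sub_neg_eq_add, add_comm (s • w)] at this
      rw [le_div_iff₀ (norm_pos_iff.2 hw0)]
      linarith
    exact isBounded_iff_forall_norm_le.2 ⟨_, hb⟩
  have hop : IsOpen (g ⁻¹' interior K) := isOpen_interior.preimage hgc
  have h0 : (0 : ℝ) ∈ g ⁻¹' interior K := by simpa [hg] using hz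
  have h0J : (0 : ℝ) ∈ J := interior_subset (s := K) h0
  -- The extreme parameters of the chord give the two boundary points. Every parameter strictly
  -- between them gives a point on an open segment from an endpoint to the interior point `z`, hence
  -- an interior point.
  obtain ⟨α, hα⟩ := hJc.exists_isLeast ⟨0, h0J⟩
  obtain ⟨β, hβ⟩ := hJc.exists_isGreatest ⟨0, h0J⟩
  have hnbd : ∀ s, g s ∈ interior K → α < s ∧ s < β := by
    intro s hs
    obtain ⟨ε, hε, hball⟩ := Metric.isOpen_iff.1 hop s hs
    have hm : s - ε / 2 ∈ J := interior_subset (s := K) (hball (by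
      rw [Metric.mem_ball, Real.dist_eq, abs_lt]; constructor <;> linarith))
    have hp : s + ε / 2 ∈ J := interior_subset (s := K) (hball (by
      rw [Metric.mem_ball, Real.dist_eq, abs_lt]; constructor <;> linarith))
    constructor
    · linarith [hα.2 hm]
    · linarith [hβ.2 hp]
  obtain ⟨hα0, hβ0⟩ := hnbd 0 h0
  have hint : ∀ s, α < s → s < β → g s ∈ interior K := by
    intro s h1 h2
    have key : ∀ γ ∈ J, ∀ c : ℝ, 0 ≤ c → c < 1 → g (c * γ) ∈ interior K := by
      intro γ hγ c hc hc1
      have := hconv.combo_interior_self_mem_interior hz hγ (sub_pos.2 hc1) hc (by ring)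
      have e : (1 - c) • z + c • g γ = g (c * γ) := by
        simp only [hg, smul_add, sub_smul, one_smul, smul_smul]
        abel
      rwa [e] at this
    rcases le_total s 0 with hs | hs
    · have := key α hα.1 (s / α) (div_nonneg_of_nonpos hs hα0.le)
        ((div_lt_one_of_neg hα0).2 h1)
      rwa [div_mul_cancel₀ _ hα0.ne] at this
    · have := key β hβ.1 (s / β) (div_nonneg hs hβ0.le) ((div_lt_one hβ0).2 h2)
      rwa [div_mul_cancel₀ _ hβ0.ne'] at this
  have hgu : ∀ s, inner ℝ u (g s) = inner ℝ u z := by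
    intro s
    simp [hg, inner_add_right, inner_smul_right, hw, inner_rot]
  refine ⟨g α, g β, fun h => by linarith [hgi h], ?_⟩
  ext x
  simp only [Set.mem_ofPred_eq, Set.mem_insert_iff, Set.mem_singleton_iff,
    hK.isClosed.frontier_eq, Set.mem_sdiff]
  constructor
  · rintro ⟨⟨hxK, hxi⟩, hx⟩
    obtain ⟨s, rfl⟩ := exists_eq_add_smul_rot hu hx.symm
    change s ∈ J at hxK
    rcases (hα.2 hxK).eq_or_lt with h | h
    · left; rw [h]
    rcases (hβ.2 hxK).eq_or_lt with h' | h'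
    · right; rw [← h']
    exact absurd (hint s h h') hxi
  · rintro (rfl | rfl)
    · exact ⟨⟨hα.1, fun h => lt_irrefl _ (hnbd _ h).1⟩, hgu _⟩
    · exact ⟨⟨hβ.1, fun h => lt_irrefl _ (hnbd _ h).2⟩, hgu _⟩

/-- A linear functional takes every intermediate value in the interior of a convex body. -/
theorem exists_mem_interior_inner_eq {K : Set Plane} (hconv : Convex ℝ K)
    (hint : (interior K).Nonempty) {u a b : Plane} {t : ℝ} (ha : a ∈ K) (hb : b ∈ K)
    (hat : inner ℝ u a < t) (htb : t < inner ℝ u b) : ∃ z ∈ interior K, inner ℝ u z = t := by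
  obtain ⟨z, hz⟩ := hint
  have key : ∀ c ∈ K, ∀ r : ℝ, 0 ≤ r → r < 1 →
      inner ℝ u z + r * (inner ℝ u c - inner ℝ u z) = t → ∃ z ∈ interior K, inner ℝ u z = t := by
    intro c hc r hr hr1 h
    refine ⟨(1 - r) • z + r • c,
      hconv.combo_interior_self_mem_interior hz hc (sub_pos.2 hr1) hr (by ring), ?_⟩
    rw [inner_add_right, inner_smul_right, inner_smul_right, ← h]
    ring
  rcases le_total (inner ℝ u z) t with h | h
  · have hpos : 0 < inner ℝ u b - inner ℝ u z := by linarith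
    refine key b hb ((t - inner ℝ u z) / (inner ℝ u b - inner ℝ u z))
      (div_nonneg (by linarith) hpos.le) ((div_lt_one hpos).2 (by linarith)) ?_
    rw [div_mul_cancel₀ _ hpos.ne']
    ring
  · have hneg : inner ℝ u a - inner ℝ u z < 0 := by linarith
    refine key a ha ((t - inner ℝ u z) / (inner ℝ u a - inner ℝ u z))
      (div_nonneg_of_nonpos (by linarith) hneg.le) ((div_lt_one_of_neg hneg).2 (by linarith)) ?_
    rw [div_mul_cancel₀ _ hneg.ne]
    ring

/-- The convex hull of finitely many points on a line is spanned by two of them. -/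
theorem exists_convexHull_eq_segment {s : Finset Plane} (hs : s.Nonempty) {u : Plane} {c : ℝ}
    (hu : u ≠ 0) (h : ∀ x ∈ s, inner ℝ u x = c) :
    ∃ p ∈ s, ∃ q ∈ s, convexHull ℝ (s : Set Plane) = segment ℝ p q := by
  obtain ⟨p, hp, hmin⟩ := s.exists_min_image (fun x => inner ℝ (rot u) x) hs
  obtain ⟨q, hq, hmax⟩ := s.exists_max_image (fun x => inner ℝ (rot u) x) hs
  refine ⟨p, hp, q, hq, Set.Subset.antisymm (convexHull_min ?_ (convex_segment p q)) ?_⟩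
  · intro x hx
    obtain ⟨a, ha⟩ := exists_eq_add_smul_rot hu ((h p hp).trans (h x hx).symm)
    obtain ⟨b, hb⟩ := exists_eq_add_smul_rot hu ((h p hp).trans (h q hq).symm)
    have hpos : 0 < inner ℝ (rot u) (rot u) := real_inner_self_pos.2 (rot_ne_zero hu)
    have ha0 : 0 ≤ a := by
      have := hmin x hx
      simp only [ha, inner_add_right, inner_smul_right] at this
      by_contra! hlt
      nlinarith
    have hab : a ≤ b := by
      have := hmax x hx
      simp only [ha, hb, inner_add_right, inner_smul_right] at this
      by_contra! hlt
      nlinarith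
    rw [segment_eq_image']
    rcases hab.eq_or_lt with e | hlt
    · refine ⟨1, by simp, ?_⟩
      simp [ha, hb, e]
    · have hb0 : 0 < b := ha0.trans_lt hlt
      refine ⟨a / b, ⟨by positivity, (div_le_one hb0).2 hab⟩, ?_⟩
      simp only [hb, add_sub_cancel_left, smul_smul, div_mul_cancel₀ _ hb0.ne']
      exact ha.symm
  · exact (convex_convexHull ℝ _).segment_subset (subset_convexHull ℝ _ hp)
      (subset_convexHull ℝ _ hq)

/-- A point of a polygon at which a linear functional is maximal lies on a segment of maximal points
between two vertices. -/
theorem exists_mem_segment_of_maximal {s : Finset Plane} {u x : Plane} (hu : u ≠ 0)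
    (hx : x ∈ convexHull ℝ (s : Set Plane))
    (hmax : ∀ y ∈ s, inner ℝ u y ≤ inner ℝ u x) :
    ∃ p ∈ s, ∃ q ∈ s, inner ℝ u p = inner ℝ u x ∧ inner ℝ u q = inner ℝ u x ∧
      x ∈ segment ℝ p q := by
  classical
  obtain ⟨w, hw0, hw1, hwx⟩ := Finset.mem_convexHull'.1 hx
  -- The value at `x` is a weighted mean of vertex values that do not exceed it, so all weight sits
  -- on vertices attaining it.
  have hsum : ∑ y ∈ s, w y * (inner ℝ u x - inner ℝ u y) = 0 := by
    have : inner ℝ u x = ∑ y ∈ s, w y * inner ℝ u y := by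
      conv_lhs => rw [← hwx, inner_sum]
      simp [inner_smul_right]
    simp only [mul_sub, Finset.sum_sub_distrib]
    rw [← Finset.sum_mul, hw1, ← this]
    ring
  have hz := (Finset.sum_eq_zero_iff_of_nonneg (fun y hy =>
    mul_nonneg (hw0 y hy) (sub_nonneg.2 (hmax y hy)))).1 hsum
  set F := s.filter fun y => inner ℝ u y = inner ℝ u x with hF
  have hout : ∀ y ∈ s, y ∉ F → w y = 0 := by
    intro y hy hyF
    rcases mul_eq_zero.1 (hz y hy) with h | h
    · exact h
    · exact absurd (Finset.mem_filter.2 ⟨hy, (sub_eq_zero.1 h).symm⟩) hyF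
  have hxF : x ∈ convexHull ℝ (F : Set Plane) := by
    refine Finset.mem_convexHull'.2 ⟨w, fun y hy => hw0 y (Finset.filter_subset _ _ hy), ?_, ?_⟩
    · rw [← hw1]
      exact Finset.sum_subset (Finset.filter_subset _ _) fun y hy h => hout y hy h
    · rw [← hwx]
      exact Finset.sum_subset (Finset.filter_subset _ _) fun y hy h => by simp [hout y hy h]
  have hFne : F.Nonempty := by
    rw [← Finset.coe_nonempty, ← convexHull_nonempty_iff (𝕜 := ℝ)]
    exact ⟨x, hxF⟩
  obtain ⟨p, hp, q, hq, hpq⟩ := exists_convexHull_eq_segment hFne hu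
    (fun y hy => (Finset.mem_filter.1 hy).2)
  exact ⟨p, (Finset.mem_filter.1 hp).1, q, (Finset.mem_filter.1 hq).1, (Finset.mem_filter.1 hp).2,
    (Finset.mem_filter.1 hq).2, hpq ▸ hxF⟩

/-- A supporting functional at `x` is maximal there, so `x` lies on a segment between two maximising
vertices; that segment misses the interior, where the functional is strictly smaller. -/
theorem exists_mem_segment_subset_frontier {s : Finset Plane}
    (hint : (interior (convexHull ℝ (s : Set Plane))).Nonempty) {x : Plane}
    (hx : x ∈ frontier (convexHull ℝ (s : Set Plane))) :
    ∃ p ∈ s, ∃ q ∈ s, x ∈ segment ℝ p q ∧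
      segment ℝ p q ⊆ frontier (convexHull ℝ (s : Set Plane)) := by
  set K := convexHull ℝ (s : Set Plane) with hKdef
  have hconv : Convex ℝ K := convex_convexHull ℝ _
  have hcl : IsClosed K := (s.finite_toSet.isCompact_convexHull (𝕜 := ℝ)).isClosed
  rw [hcl.frontier_eq] at hx ⊢
  obtain ⟨f, hf⟩ := geometric_hahn_banach_open_point hconv.interior isOpen_interior hx.2
  obtain ⟨u, rfl⟩ := (InnerProductSpace.toDual ℝ Plane).surjective f
  simp only [InnerProductSpace.toDual_apply_apply] at hf
  have hu : u ≠ 0 := by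
    rintro rfl
    obtain ⟨z, hz⟩ := hint
    simpa using hf z hz
  have hle : ∀ y ∈ K, inner ℝ u y ≤ inner ℝ u x := by
    intro y hy
    have hy' : y ∈ closure (interior K) := by
      rw [hconv.closure_interior_eq_closure_of_nonempty_interior hint]
      exact subset_closure hy
    have hcl' : IsClosed {y : Plane | inner ℝ u y ≤ inner ℝ u x} :=
      isClosed_le (by fun_prop) continuous_const
    exact closure_minimal (fun y hy => (hf y hy).le) hcl' hy'
  obtain ⟨p, hp, q, hq, hpu, hqu, hxpq⟩ := exists_mem_segment_of_maximal hu hx.1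
    fun y hy => hle y (subset_convexHull ℝ _ hy)
  refine ⟨p, hp, q, hq, hxpq, fun y hy => ⟨?_, fun hyi => ?_⟩⟩
  · exact hconv.segment_subset (subset_convexHull ℝ _ hp) (subset_convexHull ℝ _ hq) hy
  · refine (hf y hyi).ne ?_
    obtain ⟨a, b, -, -, hab, rfl⟩ := hy
    rw [inner_add_right, inner_smul_right, inner_smul_right, hpu, hqu, ← add_mul, hab, one_mul]

/-! ### Projections of segments and Cauchy's formula -/

theorem inner_lineMap (u p q : Plane) (t : ℝ) :
    inner ℝ u (AffineMap.lineMap p q t) = AffineMap.lineMap (inner ℝ u p : ℝ) (inner ℝ u q) t := by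
  simp [AffineMap.lineMap_apply, inner_add_right, inner_smul_right, inner_sub_right]

theorem inner_image_lineMap_image (u p q : Plane) (T : Set ℝ) :
    (fun x => (inner ℝ u x : ℝ)) '' (AffineMap.lineMap p q '' T) =
      AffineMap.lineMap (inner ℝ u p : ℝ) (inner ℝ u q) '' T := by
  rw [Set.image_image]
  simp_rw [inner_lineMap]

theorem volume_lineMap_image (a b : ℝ) (T : Set ℝ) :
    volume (AffineMap.lineMap a b '' T : Set ℝ) = ENNReal.ofReal |b - a| * volume T := by
  have := hausdorffMeasure_lineMap_image a b T
  rw [hausdorffMeasure_real] at this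
  rw [this, ENNReal.smul_def, smul_eq_mul, ← edist_nndist, edist_dist, Real.dist_eq, abs_sub_comm]

theorem hausdorffMeasure_lineMap_image' (p q : Plane) (T : Set ℝ) :
    Measure.hausdorffMeasure 1 (AffineMap.lineMap p q '' T : Set Plane) =
      ENNReal.ofReal ‖q - p‖ * volume T := by
  rw [hausdorffMeasure_lineMap_image, hausdorffMeasure_real, ENNReal.smul_def, smul_eq_mul,
    ← edist_nndist, edist_dist, dist_eq_norm, norm_sub_rev]

/-- The image of a set under a real affine map is measurable. -/
theorem measurableSet_lineMap_image (a b : ℝ) {T : Set ℝ} (hT : MeasurableSet T) :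
    MeasurableSet (AffineMap.lineMap a b '' T : Set ℝ) := by
  rcases eq_or_ne a b with rfl | hab
  · have : (AffineMap.lineMap a a '' T : Set ℝ) ⊆ {a} := by
      rintro _ ⟨t, -, rfl⟩
      simp
    exact (Set.subsingleton_singleton.anti this).measurableSet
  · exact hT.image_of_continuousOn_injOn (AffineMap.lineMap_continuous.continuousOn)
      (AffineMap.lineMap_injective ℝ hab).injOn

/-- Almost every line orthogonal to `u` that meets a convex body meets its boundary twice: in terms
of a partition of the boundary, up to finitely many points, into subsets `A i` of segments. -/
theorem sum_indicator_inner_image_eq {ι : Type*} [Fintype ι] {K : Set Plane} (hK : IsCompact K)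
    (hconv : Convex ℝ K) (hint : (interior K).Nonempty) {F : Set Plane} {p q : ι → Plane}
    {A : ι → Set Plane} (hp : ∀ i, p i ∈ F) (hFK : convexHull ℝ F = K)
    (hA : ∀ i, A i ⊆ segment ℝ (p i) (q i)) (hdisj : Pairwise (Function.onFun Disjoint A))
    (hAfr : ∀ i, A i ⊆ frontier K) (hfr : frontier K ⊆ F ∪ ⋃ i, A i)
    {u : Plane} (hu : u ≠ 0) {t : ℝ} (ht : t ∉ (fun x => (inner ℝ u x : ℝ)) '' F) :
    ∑ i, ((fun x => (inner ℝ u x : ℝ)) '' A i).indicator (1 : ℝ → ENNReal) t =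
      2 * ((fun x => (inner ℝ u x : ℝ)) '' K).indicator 1 t := by
  classical
  set f : Plane → ℝ := fun x => inner ℝ u x with hf
  by_cases htK : t ∈ f '' K
  · obtain ⟨y, hyK, hyt⟩ := htK
    -- No point of `F` lies on the level `t`. If `K` lay weakly on one side of that level, `F` and
    -- hence its hull would lie strictly on that side, contradicting `y`.
    have hex : (∃ a ∈ K, inner ℝ u a < t) ∧ ∃ b ∈ K, t < inner ℝ u b := by
      constructor
      · by_contra! hcon
        have hsub : K ⊆ {x : Plane | t < inner ℝ u x} := by
          rw [← hFK]
          refine convexHull_min (fun x hx => ?_)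
            (convex_halfSpace_gt (IsLinearMap.mk (fun x y => inner_add_right _ _ _)
              fun c x => inner_smul_right _ _ _) t)
          refine lt_of_le_of_ne (hcon x (hFK ▸ subset_convexHull ℝ F hx)) fun h => ht ⟨x, hx, h.symm⟩
        have h1 : t < inner ℝ u y := hsub hyK
        exact h1.ne hyt.symm
      · by_contra! hcon
        have hsub : K ⊆ {x : Plane | inner ℝ u x < t} := by
          rw [← hFK]
          refine convexHull_min (fun x hx => ?_)
            (convex_halfSpace_lt (IsLinearMap.mk (fun x y => inner_add_right _ _ _)
              fun c x => inner_smul_right _ _ _) t)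
          refine lt_of_le_of_ne (hcon x (hFK ▸ subset_convexHull ℝ F hx)) fun h => ht ⟨x, hx, h⟩
        have h1 : inner ℝ u y < t := hsub hyK
        exact h1.ne hyt
    obtain ⟨⟨a, ha, hat⟩, b, hb, htb⟩ := hex
    obtain ⟨z, hz, hzt⟩ := exists_mem_interior_inner_eq hconv hint ha hb hat htb
    obtain ⟨x, y', hxy, hpair⟩ := exists_frontier_inter_line_eq_pair hK hconv hu hz
    have hx : x ∈ frontier K ∧ inner ℝ u x = inner ℝ u z := by
      have : x ∈ ({x, y'} : Set Plane) := by simp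
      rwa [← hpair] at this
    have hy' : y' ∈ frontier K ∧ inner ℝ u y' = inner ℝ u z := by
      have : y' ∈ ({x, y'} : Set Plane) := by simp
      rwa [← hpair] at this
    have hmem : ∀ v, v ∈ frontier K ∧ inner ℝ u v = inner ℝ u z →
        ∑ i, (A i).indicator (1 : Plane → ENNReal) v = 1 := by
      intro v hv
      have hvF : v ∉ F := fun h => ht ⟨v, h, hv.2.trans hzt⟩
      obtain ⟨i, hi⟩ := Set.mem_iUnion.1 ((hfr hv.1).resolve_left hvF)
      rw [Finset.sum_eq_single i, Set.indicator_of_mem hi, Pi.one_apply]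
      · intro j _ hji
        exact Set.indicator_of_notMem (fun hj => Set.disjoint_left.1 (hdisj hji) hj hi) _
      · simp
    have hterm : ∀ i, (f '' A i).indicator (1 : ℝ → ENNReal) t =
        (A i).indicator 1 x + (A i).indicator 1 y' := by
      intro i
      -- Two distinct points of one segment at level `t` would force the functional to be constant
      -- on it, putting the endpoint `p i` at the excluded level.
      have hnot : ¬ (x ∈ A i ∧ y' ∈ A i) := by
        rintro ⟨h1, h2⟩
        have e1 := hA i h1
        have e2 := hA i h2
        rw [segment_eq_image_lineMap] at e1 e2
        obtain ⟨r1, -, rfl⟩ := e1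
        obtain ⟨r2, -, rfl⟩ := e2
        have e3 := hx.2.trans hy'.2.symm
        rw [inner_lineMap, inner_lineMap] at e3
        rcases eq_or_ne (inner ℝ u (p i) : ℝ) (inner ℝ u (q i)) with e | e
        · refine ht ⟨p i, hp i, ?_⟩
          have e4 := hx.2
          rw [inner_lineMap, ← e] at e4
          simp only [AffineMap.lineMap_same, AffineMap.const_apply] at e4
          simp [hf, e4, hzt]
        · exact hxy (congrArg _ (AffineMap.lineMap_injective ℝ e e3))
      have hiff : t ∈ f '' A i ↔ x ∈ A i ∨ y' ∈ A i := by
        constructor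
        · rintro ⟨v, hv, hvt⟩
          have : v ∈ ({x, y'} : Set Plane) := by
            rw [← hpair]
            exact ⟨hAfr i hv, by rw [hzt]; exact hvt⟩
          rcases this with rfl | rfl
          · exact Or.inl hv
          · exact Or.inr hv
        · rintro (h | h)
          · exact ⟨x, h, hx.2.trans hzt⟩
          · exact ⟨y', h, hy'.2.trans hzt⟩
      by_cases h1 : x ∈ A i <;> by_cases h2 : y' ∈ A i
      · exact absurd ⟨h1, h2⟩ hnot
      all_goals simp [hiff, h1, h2]
    simp_rw [hterm]
    rw [Finset.sum_add_distrib, hmem x hx, hmem y' hy',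
      Set.indicator_of_mem (show t ∈ f '' K from ⟨y, hyK, hyt⟩)]
    norm_num
  · rw [Set.indicator_of_notMem htK, mul_zero]
    refine Finset.sum_eq_zero fun i _ => Set.indicator_of_notMem (fun h => htK ?_) _
    obtain ⟨v, hv, hvt⟩ := h
    exact ⟨v, hK.isClosed.frontier_subset (hAfr i hv), hvt⟩

/-- Cauchy's formula for a polygon with interior. -/
theorem hausdorffMeasure_frontier_convexHull {s : Finset Plane}
    (hint : (interior (convexHull ℝ (s : Set Plane))).Nonempty) (φ : ℝ) :
    (Measure.hausdorffMeasure 1 (frontier (convexHull ℝ (s : Set Plane)))).toReal =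
      ∫ θ in (φ - Real.pi / 2)..(φ + Real.pi / 2),
        (volume ((fun x => (inner ℝ (dir θ) x : ℝ)) '' convexHull ℝ (s : Set Plane))).toReal := by
  classical
  set K := convexHull ℝ (s : Set Plane) with hKdef
  have hconv : Convex ℝ K := convex_convexHull ℝ _
  have hcomp : IsCompact K := s.finite_toSet.isCompact_convexHull (𝕜 := ℝ)
  have hsne : (s : Set Plane).Nonempty := by
    rw [← convexHull_nonempty_iff (𝕜 := ℝ)]
    exact hint.mono interior_subset
  -- Boundary segments may overlap, and each appears in both orientations; `disjointed` below
  -- removes the repetitions. Degenerate pairs are dropped so that `lineMap` is injective.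
  let I : Finset (Plane × Plane) :=
    (s ×ˢ s).filter fun a => a.1 ≠ a.2 ∧ segment ℝ a.1 a.2 ⊆ frontier K
  let e := I.equivFin
  set p : Fin I.card → Plane := fun i => (e.symm i).1.1 with hpdef
  set q : Fin I.card → Plane := fun i => (e.symm i).1.2 with hqdef
  have hmemI : ∀ i, p i ∈ s ∧ q i ∈ s ∧ p i ≠ q i ∧ segment ℝ (p i) (q i) ⊆ frontier K := by
    intro i
    have := Finset.mem_filter.1 (e.symm i).2
    rw [Finset.mem_product] at this
    exact ⟨this.1.1, this.1.2, this.2⟩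
  set A : Fin I.card → Set Plane := disjointed fun i => segment ℝ (p i) (q i) with hAdef
  have hAseg : ∀ i, A i ⊆ segment ℝ (p i) (q i) := disjointed_subset _
  have hAdisj : Pairwise (Function.onFun Disjoint A) := disjoint_disjointed _
  have hsegm : ∀ i, MeasurableSet (segment ℝ (p i) (q i)) := fun i => by
    rw [segment_eq_image_lineMap]
    exact (isCompact_Icc.image AffineMap.lineMap_continuous).measurableSet
  have hAmeas : ∀ i, MeasurableSet (A i) := fun i =>
    disjointedRec (f := fun i => segment ℝ (p i) (q i)) (p := MeasurableSet)
      (fun _ j ht => ht.diff (hsegm j)) (hsegm i)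
  have hAfr : ∀ i, A i ⊆ frontier K := fun i => (hAseg i).trans (hmemI i).2.2.2
  have hfr : frontier K ⊆ (s : Set Plane) ∪ ⋃ i, A i := by
    intro x hx
    obtain ⟨a, ha, b, hb, hxab, hab⟩ := exists_mem_segment_subset_frontier hint hx
    rcases eq_or_ne a b with rfl | hne
    · rw [segment_same, Set.mem_singleton_iff] at hxab
      exact Or.inl (hxab ▸ ha)
    · right
      rw [hAdef, iUnion_disjointed, Set.mem_iUnion]
      have hmem : (a, b) ∈ I :=
        Finset.mem_filter.2 ⟨Finset.mem_product.2 ⟨ha, hb⟩, hne, hab⟩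
      refine ⟨e ⟨(a, b), hmem⟩, ?_⟩
      simpa [hpdef, hqdef] using hxab
  -- The length of `A i` and that of its projection are both a scale factor times `volume (T i)`, so
  -- Cauchy's formula reduces to the case of one segment.
  set T : Fin I.card → Set ℝ := fun i => AffineMap.lineMap (p i) (q i) ⁻¹' A i with hTdef
  have hTmeas : ∀ i, MeasurableSet (T i) := fun i =>
    (AffineMap.lineMap_continuous (p := p i) (q := q i)).measurable (hAmeas i)
  have hAT : ∀ i, A i = AffineMap.lineMap (p i) (q i) '' T i := by
    intro i
    rw [hTdef, Set.image_preimage_eq_of_subset]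
    refine (hAseg i).trans ?_
    rw [segment_eq_image_lineMap]
    exact Set.image_subset_range _ _
  have hTsub : ∀ i, T i ⊆ Set.Icc 0 1 := by
    intro i r hr
    have h1 := hAseg i hr
    rw [segment_eq_image_lineMap] at h1
    obtain ⟨r', hr', h2⟩ := h1
    rwa [← AffineMap.lineMap_injective ℝ (hmemI i).2.2.1 h2]
  have hTfin : ∀ i, volume (T i) ≠ ⊤ := fun i =>
    measure_ne_top_of_subset (hTsub i) (by simp)
  have hlen : (Measure.hausdorffMeasure 1 (frontier K)).toReal =
      ∑ i, ‖q i - p i‖ * (volume (T i)).toReal := by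
    have h1 : Measure.hausdorffMeasure 1 (frontier K) =
        Measure.hausdorffMeasure 1 (⋃ i, A i) := by
      have : NullSingletonClass (Measure.hausdorffMeasure 1 : Measure Plane) :=
        Measure.nullSingletonClass_hausdorff _ one_pos
      refine le_antisymm ?_ (measure_mono (Set.iUnion_subset hAfr))
      refine (measure_mono hfr).trans ((measure_union_le _ _).trans ?_)
      rw [s.finite_toSet.measure_zero, zero_add]
    rw [h1, measure_iUnion hAdisj hAmeas, tsum_fintype, ENNReal.toReal_sum]
    · refine Finset.sum_congr rfl fun i _ => ?_
      rw [hAT i, hausdorffMeasure_lineMap_image', ENNReal.toReal_mul,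
        ENNReal.toReal_ofReal (norm_nonneg _)]
    · intro i _
      rw [hAT i, hausdorffMeasure_lineMap_image']
      exact ENNReal.mul_ne_top ENNReal.ofReal_ne_top (hTfin i)
  -- Integrating the two-point count over all levels `t`; the finitely many levels of vertices form
  -- a null set.
  have hwidth : ∀ θ, 2 * (volume ((fun x => (inner ℝ (dir θ) x : ℝ)) '' K)).toReal =
      ∑ i, |inner ℝ (dir θ) (q i - p i)| * (volume (T i)).toReal := by
    intro θ
    set f : Plane → ℝ := fun x => inner ℝ (dir θ) x with hf
    have hfc : Continuous f := by fun_prop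
    have hae : ∀ᵐ t : ℝ, ∑ i, (f '' A i).indicator (1 : ℝ → ENNReal) t =
        2 * (f '' K).indicator 1 t := by
      have : ∀ᵐ t : ℝ, t ∉ f '' (s : Set Plane) :=
        measure_eq_zero_iff_ae_notMem.1 ((s.finite_toSet.image f).measure_zero _)
      filter_upwards [this] with t ht
      exact sum_indicator_inner_image_eq hcomp hconv hint (fun i => (hmemI i).1) rfl hAseg
        hAdisj hAfr hfr (dir_ne_zero θ) ht
    have hPm : ∀ i, MeasurableSet (f '' A i) := fun i => by
      rw [hAT i, inner_image_lineMap_image]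
      exact measurableSet_lineMap_image _ _ (hTmeas i)
    have h2 := lintegral_congr_ae hae
    rw [lintegral_finsetSum _ fun i _ => measurable_one.indicator (hPm i),
      lintegral_const_mul _ (measurable_one.indicator (hcomp.image hfc).measurableSet),
      lintegral_indicator_one (hcomp.image hfc).measurableSet] at h2
    simp_rw [fun i => lintegral_indicator_one (μ := volume) (hPm i)] at h2
    have h3 : ∀ i, volume (f '' A i) =
        ENNReal.ofReal |inner ℝ (dir θ) (q i - p i)| * volume (T i) := fun i => by
      rw [hAT i, inner_image_lineMap_image, volume_lineMap_image, inner_sub_right]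
    simp_rw [h3] at h2
    have h4 := congrArg ENNReal.toReal h2
    rw [ENNReal.toReal_mul, ENNReal.toReal_sum fun i _ =>
      ENNReal.mul_ne_top ENNReal.ofReal_ne_top (hTfin i)] at h4
    simp only [ENNReal.toReal_mul, ENNReal.toReal_ofReal (abs_nonneg _), ENNReal.toReal_ofNat] at h4
    exact h4.symm
  have hwidth' : ∀ θ, (volume ((fun x => (inner ℝ (dir θ) x : ℝ)) '' K)).toReal =
      2⁻¹ * ∑ i, |inner ℝ (dir θ) (q i - p i)| * (volume (T i)).toReal := by
    intro θ
    rw [← hwidth θ]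
    ring
  simp_rw [hwidth']
  rw [hlen, intervalIntegral.integral_const_mul, intervalIntegral.integral_finsetSum]
  · simp_rw [intervalIntegral.integral_mul_const, integral_abs_inner_dir, mul_assoc]
    rw [← Finset.mul_sum]
    ring
  · intro i _
    exact ((continuous_inner_dir _).abs.mul continuous_const).intervalIntegrable _ _

/-- Without interior the points do not span the plane affinely, so some nonzero vector is orthogonal
to all their differences and they are collinear. -/
theorem exists_convexHull_eq_segment_of_interior_empty {s : Finset Plane} (hs : s.Nonempty)
    (hint : ¬ (interior (convexHull ℝ (s : Set Plane))).Nonempty) :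
    ∃ p q : Plane, convexHull ℝ (s : Set Plane) = segment ℝ p q := by
  rw [(convex_convexHull ℝ _).interior_nonempty_iff_affineSpan_eq_top, affineSpan_convexHull] at hint
  obtain ⟨x0, hx0⟩ := hs
  have hdir : vectorSpan ℝ (s : Set Plane) ≠ ⊤ := by
    intro h
    apply hint
    rwa [← direction_affineSpan, AffineSubspace.direction_eq_top_iff_of_nonempty
      ⟨x0, subset_affineSpan ℝ _ hx0⟩] at h
  have hperp : (vectorSpan ℝ (s : Set Plane))ᗮ ≠ ⊥ := fun h =>
    hdir (Submodule.orthogonal_eq_bot_iff.1 h)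
  obtain ⟨u, hu, hu0⟩ := Submodule.exists_mem_ne_zero_of_ne_bot hperp
  obtain ⟨p, -, q, -, h⟩ := exists_convexHull_eq_segment (s := s) ⟨x0, hx0⟩ (c := inner ℝ u x0) hu0
    fun x hx => by
      have := (Submodule.mem_orthogonal' _ _).1 hu (x - x0) (vsub_mem_vectorSpan ℝ hx hx0)
      rwa [inner_sub_right, sub_eq_zero] at this
  exact ⟨p, q, h⟩

/-- Cauchy's formula for the convex hull of finitely many points: the perimeter is the integral of
the lengths of the projections. -/
theorem perimeter_convexHull {s : Finset Plane} (hs : s.Nonempty) (φ : ℝ) :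
    perimeter (convexHull ℝ (s : Set Plane)) =
      ∫ θ in (φ - Real.pi / 2)..(φ + Real.pi / 2),
        (volume ((fun x => (inner ℝ (dir θ) x : ℝ)) '' convexHull ℝ (s : Set Plane))).toReal := by
  rw [perimeter]
  split_ifs with hint
  · exact hausdorffMeasure_frontier_convexHull hint φ
  · have hcl : IsClosed (convexHull ℝ (s : Set Plane)) :=
      (s.finite_toSet.isCompact_convexHull (𝕜 := ℝ)).isClosed
    rw [hcl.frontier_eq, Set.not_nonempty_iff_eq_empty.1 hint, Set.sdiff_empty]
    obtain ⟨p, q, h⟩ := exists_convexHull_eq_segment_of_interior_empty hs hint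
    rw [h, hausdorffMeasure_segment, edist_dist, ENNReal.toReal_ofReal dist_nonneg]
    have h2 : ∀ θ, (volume ((fun x => (inner ℝ (dir θ) x : ℝ)) '' segment ℝ p q)).toReal =
        |inner ℝ (dir θ) (q - p)| := by
      intro θ
      rw [segment_eq_image_lineMap, inner_image_lineMap_image, volume_lineMap_image,
        inner_sub_right]
      simp
    simp_rw [h2, integral_abs_inner_dir, dist_eq_norm, norm_sub_rev p q]

/-! ### The Lindley recursion and its second moments -/

/-- The Lindley recursion `W₀ = 0`, `Wₙ₊₁ = (Wₙ + Xₙ)⁺`. -/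
noncomputable def lindley (X : ℕ → ℝ) : ℕ → ℝ
  | 0 => 0
  | n + 1 => max (lindley X n + X n) 0

theorem lindley_nonneg (X : ℕ → ℝ) (n : ℕ) : 0 ≤ lindley X n := by
  cases n with
  | zero => exact le_rfl
  | succ n => exact le_max_right _ _

/-- Subadditivity is what allows increments to be split into a truncated part and a remainder. -/
theorem lindley_add_le (X Y : ℕ → ℝ) (n : ℕ) :
    lindley (fun i => X i + Y i) n ≤ lindley X n + lindley Y n := by
  induction n with
  | zero => simp [lindley]
  | succ n ih =>
    have h1 : lindley X n + X n ≤ lindley X (n + 1) := le_max_left _ _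
    have h2 : lindley Y n + Y n ≤ lindley Y (n + 1) := le_max_left _ _
    exact max_le (by linarith) (add_nonneg (lindley_nonneg X _) (lindley_nonneg Y _))

theorem lindley_congr {X Y : ℕ → ℝ} {n : ℕ} (h : ∀ i < n, X i = Y i) :
    lindley X n = lindley Y n := by
  induction n with
  | zero => rfl
  | succ n ih =>
    rw [lindley, lindley, ih fun i hi => h i (hi.trans n.lt_succ_self), h n n.lt_succ_self]

theorem sum_Ico_le_lindley (X : ℕ → ℝ) {j n : ℕ} (h : j ≤ n) :
    ∑ i ∈ Finset.Ico j n, X i ≤ lindley X n := by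
  induction n, h using Nat.le_induction with
  | base => simpa using lindley_nonneg X j
  | succ n hn ih =>
    rw [Finset.sum_Ico_succ_top hn]
    exact (add_le_add_left ih (X n)).trans (le_max_left _ _)

/-- Together with `sum_Ico_le_lindley`, this identifies the recursion with the maximum of the suffix
sums, the empty one included. -/
theorem exists_lindley_eq_sum_Ico (X : ℕ → ℝ) (n : ℕ) :
    ∃ j ≤ n, lindley X n = ∑ i ∈ Finset.Ico j n, X i := by
  induction n with
  | zero => exact ⟨0, le_rfl, by simp [lindley]⟩
  | succ n ih =>
    obtain ⟨j, hj, h⟩ := ih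
    rcases le_total (lindley X n + X n) 0 with h0 | h0
    · exact ⟨n + 1, le_rfl, by simp [lindley, h0]⟩
    · exact ⟨j, hj.trans n.le_succ, by
        rw [Finset.sum_Ico_succ_top hj, ← h, lindley, max_eq_left h0]⟩

theorem measurable_lindley {α : Type*} [MeasurableSpace α] {X : ℕ → α → ℝ}
    (hX : ∀ i, Measurable (X i)) (n : ℕ) : Measurable fun a => lindley (fun i => X i a) n := by
  induction n with
  | zero => exact measurable_const
  | succ n ih => exact (ih.add (hX n)).max measurable_const

section Random

variable {Ω : Type*} [MeasurableSpace Ω] {P : Measure Ω}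
  {X : ℕ → Ω → ℝ} {Y : Ω → ℝ}

theorem indepFun_lindley (hX : ∀ i, Measurable (X i)) (hind : iIndepFun X P) (n : ℕ) :
    IndepFun (fun ω => lindley (fun i => X i ω) n) (X n) P := by
  have h := hind.indepFun_finset (Finset.range n) {n} (by simp) hX
  have hg : Measurable fun x : (Finset.range n → ℝ) =>
      lindley (fun i => if h : i ∈ Finset.range n then x ⟨i, h⟩ else 0) n := by
    refine measurable_lindley (X := fun i (x : Finset.range n → ℝ) =>
      if h : i ∈ Finset.range n then x ⟨i, h⟩ else 0) (fun i => ?_) n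
    by_cases hi : i ∈ Finset.range n
    · simp only [hi, dite_true]
      exact measurable_pi_apply _
    · simp only [hi, dite_false]
      exact measurable_const
  have hg' : Measurable fun x : (({n} : Finset ℕ) → ℝ) => x ⟨n, by simp⟩ := measurable_pi_apply _
  have h2 := h.comp hg hg'
  refine h2.congr (ae_of_all _ fun ω => ?_) (ae_of_all _ fun ω => rfl)
  exact (lindley_congr fun i hi => by simp [hi])

/-- For centred or negative increments, the second moment of the Lindley recursion grows at most
linearly. -/
theorem integral_lindley_sq_le (hX : ∀ i, Measurable (X i)) (hind : iIndepFun X P)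
    (hid : ∀ i, IdentDistrib (X i) Y P P) (hY : MemLp Y 2 P) (hneg : ∫ ω, Y ω ∂P ≤ 0) (n : ℕ) :
    MemLp (fun ω => lindley (fun i => X i ω) n) 2 P ∧
      ∫ ω, lindley (fun i => X i ω) n ^ 2 ∂P ≤ n * ∫ ω, Y ω ^ 2 ∂P := by
  induction n with
  | zero =>
    refine ⟨?_, by simp [lindley]⟩
    simp only [lindley]
    exact MemLp.zero
  | succ n ih =>
    obtain ⟨hW, hle⟩ := ih
    set W : Ω → ℝ := fun ω => lindley (fun i => X i ω) n with hWdef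
    have hXn : MemLp (X n) 2 P := (hid n).symm.memLp_iff.1 hY
    have hadd : MemLp (fun ω => W ω + X n ω) 2 P := hW.add hXn
    have hmem : MemLp (fun ω => lindley (fun i => X i ω) (n + 1)) 2 P := by
      refine hadd.mono (measurable_lindley hX _).aestronglyMeasurable (ae_of_all _ fun ω => ?_)
      rw [Real.norm_of_nonneg (lindley_nonneg _ _), Real.norm_eq_abs]
      exact max_le (le_abs_self _) (abs_nonneg _)
    refine ⟨hmem, ?_⟩
    have hprod : ∫ ω, W ω * X n ω ∂P = (∫ ω, W ω ∂P) * ∫ ω, X n ω ∂P :=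
      (indepFun_lindley hX hind n).integral_fun_mul_eq_mul_integral hW.1 hXn.1
    have hWX : Integrable (fun ω => W ω * X n ω) P := hW.integrable_mul hXn
    -- Reflection at `0` only decreases the square, and by independence the cross term is `2 𝔼[W]
    -- 𝔼[Y] ≤ 0`; each step therefore adds at most `𝔼[Y²]`.
    have h1 : ∫ ω, lindley (fun i => X i ω) (n + 1) ^ 2 ∂P ≤
        ∫ ω, (W ω ^ 2 + 2 * (W ω * X n ω) + X n ω ^ 2) ∂P := by
      refine integral_mono hmem.integrable_sq
        ((hW.integrable_sq.add (hWX.const_mul 2)).add hXn.integrable_sq) fun ω => ?_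
      have : lindley (fun i => X i ω) (n + 1) ^ 2 ≤ (W ω + X n ω) ^ 2 := by
        rw [← sq_abs (W ω + X n ω)]
        exact pow_le_pow_left₀ (lindley_nonneg _ _) (max_le (le_abs_self _) (abs_nonneg _)) 2
      calc _ ≤ _ := this
        _ = _ := by ring
    rw [integral_add (f := fun ω => W ω ^ 2 + 2 * (W ω * X n ω))
      (hW.integrable_sq.add (hWX.const_mul 2)) hXn.integrable_sq,
      integral_add hW.integrable_sq (hWX.const_mul 2), integral_const_mul, hprod] at h1
    have h2 : ∫ ω, X n ω ∂P = ∫ ω, Y ω ∂P := (hid n).integral_eq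
    have h3 : ∫ ω, X n ω ^ 2 ∂P = ∫ ω, Y ω ^ 2 ∂P :=
      ((hid n).comp (measurable_id.pow_const 2)).integral_eq
    have h4 : (∫ ω, W ω ∂P) * ∫ ω, Y ω ∂P ≤ 0 :=
      mul_nonpos_of_nonneg_of_nonpos (integral_nonneg fun ω => lindley_nonneg _ _) hneg
    rw [h2, h3] at h1
    push_cast
    linarith

/-- Since `exp (max a 0) ≤ 1 + exp a` for `a` multiplied by `l` as well, independence gives `aₙ₊₁ ≤
1 + ρ aₙ` for the exponential moments, and `(1 - ρ)⁻¹` is the fixed point. -/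
theorem integral_exp_lindley_le [IsProbabilityMeasure P] (hX : ∀ i, Measurable (X i))
    (hind : iIndepFun X P)
    (hid : ∀ i, IdentDistrib (X i) Y P P) {l ρ : ℝ} (hρ : ρ < 1)
    (hint : Integrable (fun ω => Real.exp (l * Y ω)) P)
    (hmgf : ∫ ω, Real.exp (l * Y ω) ∂P = ρ) (n : ℕ) :
    Integrable (fun ω => Real.exp (l * lindley (fun i => X i ω) n)) P ∧
      ∫ ω, Real.exp (l * lindley (fun i => X i ω) n) ∂P ≤ (1 - ρ)⁻¹ := by
  have hρ0 : 0 ≤ ρ := hmgf ▸ integral_nonneg fun ω => (Real.exp_pos _).le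
  have h1ρ : 0 < 1 - ρ := sub_pos.2 hρ
  have hm : Measurable fun x : ℝ => Real.exp (l * x) := by fun_prop
  induction n with
  | zero =>
    simp only [lindley, mul_zero, Real.exp_zero, integral_const, probReal_univ, smul_eq_mul]
    exact ⟨integrable_const _, by rw [one_mul]; exact (one_le_inv₀ h1ρ).2 (by linarith)⟩
  | succ n ih =>
    obtain ⟨hI, hle⟩ := ih
    have hXi : Integrable (fun ω => Real.exp (l * X n ω)) P :=
      ((hid n).comp hm).integrable_iff.2 hint
    have hXe : ∫ ω, Real.exp (l * X n ω) ∂P = ρ := hmgf ▸ ((hid n).comp hm).integral_eq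
    have hindep := (indepFun_lindley hX hind n).comp hm hm
    have hprodI : Integrable (fun ω => Real.exp (l * lindley (fun i => X i ω) n) *
        Real.exp (l * X n ω)) P := hindep.integrable_mul hI hXi
    have hprod : ∫ ω, Real.exp (l * lindley (fun i => X i ω) n) * Real.exp (l * X n ω) ∂P =
        (∫ ω, Real.exp (l * lindley (fun i => X i ω) n) ∂P) * ρ := by
      rw [← hXe]
      exact hindep.integral_fun_mul_eq_mul_integral hI.1 hXi.1
    have hpt : ∀ ω, Real.exp (l * lindley (fun i => X i ω) (n + 1)) ≤
        1 + Real.exp (l * lindley (fun i => X i ω) n) * Real.exp (l * X n ω) := by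
      intro ω
      rw [← Real.exp_add, ← mul_add, lindley]
      rcases le_total (lindley (fun i => X i ω) n + X n ω) 0 with h | h
      · rw [max_eq_right h, mul_zero, Real.exp_zero]
        linarith [Real.exp_pos (l * (lindley (fun i => X i ω) n + X n ω))]
      · rw [max_eq_left h]
        linarith
    have hbI := (integrable_const (1 : ℝ)).add hprodI
    have hnew : Integrable (fun ω => Real.exp (l * lindley (fun i => X i ω) (n + 1))) P := by
      refine hbI.mono (hm.comp (measurable_lindley hX _)).aestronglyMeasurable
        (ae_of_all _ fun ω => ?_)
      rw [Real.norm_of_nonneg (Real.exp_pos _).le]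
      exact (hpt ω).trans (le_abs_self _)
    refine ⟨hnew, (integral_mono hnew hbI hpt).trans ?_⟩
    simp only [Pi.add_apply]
    rw [integral_add (integrable_const _) hprodI, hprod]
    simp only [integral_const, probReal_univ, smul_eq_mul, one_mul]
    calc 1 + (∫ ω, Real.exp (l * lindley (fun i => X i ω) n) ∂P) * ρ
        ≤ 1 + (1 - ρ)⁻¹ * ρ := by gcongr
      _ = (1 - ρ)⁻¹ := by field_simp; ring

/-- A bounded variable with negative mean has an exponential moment smaller than `1`. -/
theorem exists_integral_exp_lt_one [IsProbabilityMeasure P] (hY : Measurable Y) {K : ℝ}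
    (hK : ∀ ω, |Y ω| ≤ K)
    (hneg : ∫ ω, Y ω ∂P < 0) :
    ∃ l > 0, Integrable (fun ω => Real.exp (l * Y ω)) P ∧ ∫ ω, Real.exp (l * Y ω) ∂P < 1 := by
  set m := -∫ ω, Y ω ∂P with hm
  have hm0 : 0 < m := by linarith
  have hYI : Integrable Y P := Integrable.of_bound hY.aestronglyMeasurable K (ae_of_all _ hK)
  have hK0 : 0 ≤ K := by
    obtain ⟨ω⟩ : Nonempty Ω := nonempty_of_isProbabilityMeasure P
    exact (abs_nonneg _).trans (hK ω)
  -- The first bound gives `|l Y| ≤ 1`, so `exp x ≤ 1 + x + x²` applies; the second makes `l² K²`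
  -- smaller than the gain `l m`. Using `K + 1` allows `K = 0`.
  set l := min (1 / (K + 1)) (m / (2 * (K + 1) ^ 2)) with hl
  have hl0 : 0 < l := by positivity
  have hlK : l * (K + 1) ≤ 1 := by
    rw [← le_div_iff₀ (by positivity)]
    exact min_le_left _ _
  have hlm : l * (2 * (K + 1) ^ 2) ≤ m := by
    rw [← le_div_iff₀ (by positivity)]
    exact min_le_right _ _
  have hly : ∀ ω, |l * Y ω| ≤ l * K := fun ω => by
    rw [abs_mul, abs_of_pos hl0]
    exact mul_le_mul_of_nonneg_left (hK ω) hl0.le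
  have hI : Integrable (fun ω => Real.exp (l * Y ω)) P := by
    refine Integrable.of_bound (by fun_prop) (Real.exp (l * K)) (ae_of_all _ fun ω => ?_)
    rw [Real.norm_of_nonneg (Real.exp_pos _).le]
    exact Real.exp_le_exp.2 ((le_abs_self _).trans (hly ω))
  refine ⟨l, hl0, hI, ?_⟩
  have hpt : ∀ ω, Real.exp (l * Y ω) ≤ l * Y ω + (1 + (l * K) ^ 2) := by
    intro ω
    have h1 : |l * Y ω| ≤ 1 := (hly ω).trans (by nlinarith)
    have h2 := (abs_le.1 (Real.abs_exp_sub_one_sub_id_le h1)).2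
    have h3 : (l * Y ω) ^ 2 ≤ (l * K) ^ 2 := sq_le_sq' (abs_le.1 (hly ω)).1 (abs_le.1 (hly ω)).2
    linarith
  have h := integral_mono hI ((hYI.const_mul l).add (integrable_const _)) hpt
  simp only [Pi.add_apply] at h
  rw [integral_add (hYI.const_mul l) (integrable_const _), integral_const_mul] at h
  simp only [integral_const, probReal_univ, smul_eq_mul, one_mul] at h
  have h5 : l * K ^ 2 < m := by nlinarith
  have h6 : (∫ ω, Y ω ∂P) = -m := by rw [hm, neg_neg]
  rw [h6] at h
  nlinarith

theorem exists_integral_lindley_sq_le_of_bounded [IsProbabilityMeasure P]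
    (hY : Measurable Y) {K : ℝ}
    (hK : ∀ ω, |Y ω| ≤ K) (hneg : ∫ ω, Y ω ∂P < 0) :
    ∃ C, ∀ X : ℕ → Ω → ℝ, (∀ i, Measurable (X i)) → iIndepFun X P →
      (∀ i, IdentDistrib (X i) Y P P) → ∀ n, ∫ ω, lindley (fun i => X i ω) n ^ 2 ∂P ≤ C := by
  obtain ⟨l, hl, hI, hlt⟩ := exists_integral_exp_lt_one hY hK hneg
  -- From `x² ≤ 2 exp x` at `x = l W ≥ 0`.
  refine ⟨2 / l ^ 2 * (1 - ∫ ω, Real.exp (l * Y ω) ∂P)⁻¹, fun X hX hind hid n => ?_⟩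
  obtain ⟨hWI, hle⟩ := integral_exp_lindley_le hX hind hid hlt hI rfl n
  have hY2 : MemLp Y 2 P := MemLp.of_bound hY.aestronglyMeasurable K (ae_of_all _ hK)
  refine (integral_mono (integral_lindley_sq_le hX hind hid hY2 hneg.le n).1.integrable_sq
    (hWI.const_mul (2 / l ^ 2)) fun ω => ?_).trans ?_
  · have hn := lindley_nonneg (fun i => X i ω) n
    have h1 := Real.quadratic_le_exp_of_nonneg (mul_nonneg hl.le hn)
    have h2 : 0 ≤ l * lindley (fun i => X i ω) n := by positivity
    dsimp only
    rw [div_mul_eq_mul_div, le_div_iff₀ (by positivity)]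
    nlinarith
  · rw [integral_const_mul]
    gcongr

/-- Truncation at level `K`. -/
def clamp (K x : ℝ) : ℝ := max (-K) (min x K)

theorem measurable_clamp (K : ℝ) : Measurable (clamp K) :=
  measurable_const.max (measurable_id.min measurable_const)

theorem abs_clamp_le {K : ℝ} (hK : 0 ≤ K) (x : ℝ) : |clamp K x| ≤ K :=
  abs_le.2 ⟨le_max_left _ _, max_le (by linarith) (min_le_right _ _)⟩

theorem clamp_of_abs_le {K x : ℝ} (h : |x| ≤ K) : clamp K x = x := by
  rw [clamp, min_eq_left (abs_le.1 h).2, max_eq_right (abs_le.1 h).1]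

theorem abs_sub_clamp_le {K : ℝ} (hK : 0 ≤ K) (x : ℝ) : |x - clamp K x| ≤ |x| := by
  rw [clamp]
  rcases le_total x K with h | h
  · rw [min_eq_left h]
    rcases le_total (-K) x with h' | h'
    · rw [max_eq_right h']; simp
    · rw [max_eq_left h', abs_of_nonpos (by linarith), abs_of_nonpos (by linarith)]; linarith
  · rw [min_eq_right h, max_eq_right (by linarith), abs_of_nonneg (by linarith),
      abs_of_nonneg (by linarith)]; linarith

theorem tendsto_integral_sub_clamp_sq (hY : Measurable Y) (hY2 : MemLp Y 2 P) :
    Tendsto (fun K : ℕ => ∫ ω, (Y ω - clamp K (Y ω)) ^ 2 ∂P) atTop (𝓝 0) := by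
  have h0 : (0 : ℝ) = ∫ _, (0 : ℝ) ∂P := by simp
  rw [h0]
  refine tendsto_integral_of_dominated_convergence (fun ω => Y ω ^ 2) (fun K => ?_)
    hY2.integrable_sq (fun K => ae_of_all _ fun ω => ?_) (ae_of_all _ fun ω => ?_)
  · exact ((hY.sub ((measurable_clamp _).comp hY)).pow_const 2).aestronglyMeasurable
  · rw [Real.norm_of_nonneg (sq_nonneg _)]
    exact sq_le_sq.2 (abs_sub_clamp_le K.cast_nonneg _)
  · refine tendsto_const_nhds.congr' ?_
    filter_upwards [eventually_ge_atTop ⌈|Y ω|⌉₊] with K hK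
    rw [clamp_of_abs_le (Nat.ceil_le.1 hK)]
    simp

/-- For increments of negative mean, the second moment of the Lindley recursion grows sublinearly,
uniformly over all i.i.d. sequences with a given marginal. -/
theorem exists_integral_lindley_sq_le [IsProbabilityMeasure P] (hY : Measurable Y)
    (hY2 : MemLp Y 2 P)
    (hneg : ∫ ω, Y ω ∂P < 0) {ε : ℝ} (hε : 0 < ε) :
    ∃ C, ∀ X : ℕ → Ω → ℝ, (∀ i, Measurable (X i)) → iIndepFun X P →
      (∀ i, IdentDistrib (X i) Y P P) → ∀ n : ℕ,
        ∫ ω, lindley (fun i => X i ω) n ^ 2 ∂P ≤ C + ε * n := by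
  obtain ⟨K, hK⟩ := ((tendsto_integral_sub_clamp_sq hY hY2).eventually
    (gt_mem_nhds (half_pos hε))).exists
  have hYI : Integrable Y P := hY2.integrable (by norm_num)
  have hcm := measurable_clamp (K : ℝ)
  have hK0 : (0 : ℝ) ≤ K := K.cast_nonneg
  have hcl2 : MemLp (fun ω => clamp K (Y ω)) 2 P :=
    MemLp.of_bound (hcm.comp hY).aestronglyMeasurable K (ae_of_all _ fun ω => abs_clamp_le hK0 _)
  have hclI : Integrable (fun ω => clamp K (Y ω)) P := hcl2.integrable (by norm_num)
  -- Moving `c` to the truncated part leaves it the negative mean of `Y` and centres the remainder,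
  -- whose second moment is then a variance and only decreases.
  set c := ∫ ω, (Y ω - clamp K (Y ω)) ∂P with hc
  have hc' : c = (∫ ω, Y ω ∂P) - ∫ ω, clamp K (Y ω) ∂P := integral_sub hYI hclI
  have hf1 : Measurable fun x => clamp K x + c := hcm.add_const c
  have hf2 : Measurable fun x => x - clamp K x - c := (measurable_id.sub hcm).sub_const c
  have hmean1 : ∫ ω, (clamp K (Y ω) + c) ∂P < 0 := by
    rw [integral_add hclI (integrable_const _)]
    simp only [integral_const, probReal_univ, smul_eq_mul, one_mul]
    linarith
  obtain ⟨C, hC⟩ := exists_integral_lindley_sq_le_of_bounded (hf1.comp hY) (K := K + |c|)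
    (fun ω => (abs_add_le _ _).trans (by gcongr; exact abs_clamp_le hK0 _)) hmean1
  have hd2 : MemLp (fun ω => Y ω - clamp K (Y ω)) 2 P := hY2.sub hcl2
  have hY2' : MemLp (fun ω => Y ω - clamp K (Y ω) - c) 2 P := hd2.sub (memLp_const c)
  have hmean2 : ∫ ω, (Y ω - clamp K (Y ω) - c) ∂P ≤ 0 := by
    rw [integral_sub (f := fun ω => Y ω - clamp K (Y ω)) (hYI.sub hclI) (integrable_const _)]
    simp [← hc]
  have hvar : ∫ ω, (Y ω - clamp K (Y ω) - c) ^ 2 ∂P ≤ ε / 2 := by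
    have h1 := variance_le_expectation_sq (X := fun ω => Y ω - clamp K (Y ω)) hd2.1
    rw [variance_eq_integral hd2.aemeasurable] at h1
    exact h1.trans hK.le
  refine ⟨2 * C, fun X hX hind hid n => ?_⟩
  have hX1 : ∀ i, IdentDistrib (fun ω => clamp K (X i ω) + c) (fun ω => clamp K (Y ω) + c) P P :=
    fun i => (hid i).comp hf1
  have hX2 : ∀ i, IdentDistrib (fun ω => X i ω - clamp K (X i ω) - c)
    (fun ω => Y ω - clamp K (Y ω) - c) P P := fun i => (hid i).comp hf2
  have hi1 : iIndepFun (fun i ω => clamp K (X i ω) + c) P := hind.comp _ fun _ => hf1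
  have hi2 : iIndepFun (fun i ω => X i ω - clamp K (X i ω) - c) P := hind.comp _ fun _ => hf2
  have b1 : ∫ ω, lindley (fun i => clamp K (X i ω) + c) n ^ 2 ∂P ≤ C :=
    hC _ (fun i => hf1.comp (hX i)) hi1 hX1 n
  have m2 : MemLp (fun ω => lindley (fun i => X i ω - clamp K (X i ω) - c) n) 2 P :=
    (integral_lindley_sq_le (fun i => hf2.comp (hX i)) hi2 hX2 hY2' hmean2 n).1
  have b2 : ∫ ω, lindley (fun i => X i ω - clamp K (X i ω) - c) n ^ 2 ∂P ≤
      n * ∫ ω, (Y ω - clamp K (Y ω) - c) ^ 2 ∂P :=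
    (integral_lindley_sq_le (fun i => hf2.comp (hX i)) hi2 hX2 hY2' hmean2 n).2
  have hm1 : MemLp (fun ω => clamp K (Y ω) + c) 2 P := hcl2.add (memLp_const c)
  have m1 : MemLp (fun ω => lindley (fun i => clamp K (X i ω) + c) n) 2 P :=
    (integral_lindley_sq_le (fun i => hf1.comp (hX i)) hi1 hX1 hm1 hmean1.le n).1
  have hb : ∫ ω, lindley (fun i => X i ω) n ^ 2 ∂P ≤
      ∫ ω, (2 * lindley (fun i => clamp K (X i ω) + c) n ^ 2 +
        2 * lindley (fun i => X i ω - clamp K (X i ω) - c) n ^ 2) ∂P := by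
    refine integral_mono (integral_lindley_sq_le hX hind hid hY2 hneg.le n).1.integrable_sq
      ((m1.integrable_sq.const_mul 2).add (m2.integrable_sq.const_mul 2)) fun ω => ?_
    have h0 := lindley_nonneg (fun i => X i ω) n
    have e : (fun i => clamp K (X i ω) + c + (X i ω - clamp K (X i ω) - c)) = fun i => X i ω := by
      funext i; ring
    have h := lindley_add_le (fun i => clamp K (X i ω) + c)
      (fun i => X i ω - clamp K (X i ω) - c) n
    rw [e] at h
    dsimp only
    nlinarith [sq_nonneg (lindley (fun i => clamp K (X i ω) + c) n -
      lindley (fun i => X i ω - clamp K (X i ω) - c) n)]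
  rw [integral_add (m1.integrable_sq.const_mul 2) (m2.integrable_sq.const_mul 2),
    integral_const_mul, integral_const_mul] at hb
  have : (n : ℝ) * ∫ ω, (Y ω - clamp K (Y ω) - c) ^ 2 ∂P ≤ n * (ε / 2) := by gcongr
  linarith

end Random

/-! ### Time reversal, the excess, and the decomposition of the perimeter -/

/-- The permutation of `ℕ` reversing the order of `0, …, n - 1`. -/
def revBelow (n i : ℕ) : ℕ := if i < n then n - 1 - i else i

theorem revBelow_injective (n : ℕ) : Function.Injective (revBelow n) := by
  intro i j h
  simp only [revBelow] at h
  split_ifs at h <;> omega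

theorem sum_Ico_revBelow (X : ℕ → ℝ) {j n : ℕ} (h : j ≤ n) :
    ∑ i ∈ Finset.Ico (n - j) n, X (revBelow n i) = ∑ i ∈ Finset.range j, X i := by
  refine Finset.sum_nbij' (fun i => n - 1 - i) (fun i => n - 1 - i) ?_ ?_ ?_ ?_ ?_
  · intro i hi; simp only [Finset.mem_Ico, Finset.mem_range] at *; omega
  · intro i hi; simp only [Finset.mem_Ico, Finset.mem_range] at *; omega
  · intro i hi; simp only [Finset.mem_Ico] at *; omega
  · intro i hi; simp only [Finset.mem_range] at *; omega
  · intro i hi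
    simp only [Finset.mem_Ico] at hi
    simp [revBelow, hi.2]

/-- Reversal turns suffix sums into prefix sums, so the maximum of the walk itself is a Lindley
value of the reversed increments. -/
theorem sum_range_le_lindley_revBelow (X : ℕ → ℝ) {j n : ℕ} (h : j ≤ n) :
    ∑ i ∈ Finset.range j, X i ≤ lindley (fun i => X (revBelow n i)) n := by
  rw [← sum_Ico_revBelow X h]
  exact sum_Ico_le_lindley _ (n.sub_le j)

theorem exists_lindley_revBelow_eq_sum (X : ℕ → ℝ) (n : ℕ) :
    ∃ j ≤ n, lindley (fun i => X (revBelow n i)) n = ∑ i ∈ Finset.range j, X i := by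
  obtain ⟨j, hj, h⟩ := exists_lindley_eq_sum_Ico (fun i => X (revBelow n i)) n
  refine ⟨n - j, n.sub_le j, ?_⟩
  rw [h, ← sum_Ico_revBelow X (n.sub_le j), Nat.sub_sub_self hj]

theorem convexHull_eq_Icc {E : Set ℝ} {m M : ℝ} (hm : m ∈ E) (hM : M ∈ E)
    (h : ∀ x ∈ E, x ∈ Set.Icc m M) : convexHull ℝ E = Set.Icc m M := by
  refine Set.Subset.antisymm (convexHull_min h (convex_Icc m M)) ?_
  rw [← segment_eq_Icc (h m hm).2]
  exact (convex_convexHull ℝ E).segment_subset (subset_convexHull ℝ E hm) (subset_convexHull ℝ E hM)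

variable {Ω : Type*}

/-- The sum of the overshoots of the walk in direction `u` above its final value and in
direction `-u` above its initial value. -/
noncomputable def excess (Z : ℕ → Ω → Plane) (n : ℕ) (u : Plane) (ω : Ω) : ℝ :=
  lindley (fun i => -inner ℝ u (Z i ω)) n + lindley (fun i => -inner ℝ u (Z (revBelow n i) ω)) n

theorem excess_nonneg (Z : ℕ → Ω → Plane) (n : ℕ) (u : Plane) (ω : Ω) : 0 ≤ excess Z n u ω :=
  add_nonneg (lindley_nonneg _ _) (lindley_nonneg _ _)

theorem inner_walk (Z : ℕ → Ω → Plane) (n : ℕ) (u : Plane) (ω : Ω) :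
    inner ℝ u (walk Z n ω) = ∑ i ∈ Finset.range n, inner ℝ u (Z i ω) := by
  rw [walk, inner_sum]

/-- The projection of the hull of the walk has length `u · Sₙ` plus the excess. -/
theorem volume_inner_image_hull (Z : ℕ → Ω → Plane) (n : ℕ) (u : Plane) (ω : Ω) :
    (volume ((fun x => (inner ℝ u x : ℝ)) '' hull Z n ω)).toReal =
      inner ℝ u (walk Z n ω) + excess Z n u ω := by
  set X : ℕ → ℝ := fun i => -inner ℝ u (Z i ω) with hX
  have h1 : (fun x => (inner ℝ u x : ℝ)) '' hull Z n ω =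
      convexHull ℝ ((fun j : ℕ => (inner ℝ u (walk Z j ω) : ℝ)) '' Set.Iic n) := by
    have := (innerₗ Plane u).image_convexHull ((fun j : ℕ => walk Z j ω) '' Set.Iic n)
    rw [Set.image_image] at this
    exact this
  have hneg : ∀ j, inner ℝ u (walk Z j ω) = -∑ i ∈ Finset.range j, X i := by
    intro j
    simp [hX, inner_walk]
  have htop : ∀ j ≤ n, inner ℝ u (walk Z j ω) =
      inner ℝ u (walk Z n ω) + ∑ i ∈ Finset.Ico j n, X i := by
    intro j hj
    rw [hneg, hneg, ← Finset.sum_range_add_sum_Ico X hj]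
    ring
  obtain ⟨a, ha, hae⟩ := exists_lindley_eq_sum_Ico X n
  obtain ⟨b, hb, hbe⟩ := exists_lindley_revBelow_eq_sum X n
  -- As `X` is minus the projected increments, its suffix sums are `u·Sⱼ - u·Sₙ` and its prefix sums
  -- are `-u·Sⱼ`: the former give the maximum, the latter the minimum.
  have h2 : convexHull ℝ ((fun j : ℕ => (inner ℝ u (walk Z j ω) : ℝ)) '' Set.Iic n) =
      Set.Icc (-lindley (fun i => X (revBelow n i)) n)
        (inner ℝ u (walk Z n ω) + lindley X n) := by
    refine convexHull_eq_Icc ⟨b, hb, ?_⟩ ⟨a, ha, ?_⟩ ?_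
    · simp only [hneg, hbe]
    · simp only [htop a ha, hae]
    · rintro _ ⟨j, hj, rfl⟩
      constructor
      · simp only [hneg]
        exact neg_le_neg (sum_range_le_lindley_revBelow X hj)
      · simp only [htop j hj]
        gcongr
        exact sum_Ico_le_lindley X hj
  have h0 : 0 ≤ inner ℝ u (walk Z n ω) + lindley X n := by
    have := sum_Ico_le_lindley X n.zero_le
    rw [hneg]
    rw [← Finset.range_eq_Ico] at this
    linarith
  have h3 := lindley_nonneg (fun i => X (revBelow n i)) n
  rw [h1, h2, Real.volume_Icc, ENNReal.toReal_ofReal (by linarith), excess]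
  simp only [hX]
  ring

theorem continuous_excess (Z : ℕ → Ω → Plane) (n : ℕ) (ω : Ω) :
    Continuous fun θ => excess Z n (dir θ) ω := by
  have key : ∀ (z : ℕ → Plane) (n : ℕ),
      Continuous fun θ => lindley (fun i => -inner ℝ (dir θ) (z i)) n := by
    intro z n
    induction n with
    | zero => exact continuous_const
    | succ n ih => exact (ih.add (continuous_inner_dir _).neg).max continuous_const
  exact (key (fun i => Z i ω) n).add (key (fun i => Z (revBelow n i) ω) n)

theorem integral_inner_dir (φ : ℝ) (v : Plane) :
    ∫ θ in (φ - Real.pi / 2)..(φ + Real.pi / 2), inner ℝ (dir θ) v = 2 * inner ℝ (dir φ) v := by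
  simp_rw [inner_dir]
  rw [intervalIntegral.integral_add
    (Continuous.intervalIntegrable (by fun_prop) _ _)
    (Continuous.intervalIntegrable (by fun_prop) _ _),
    intervalIntegral.integral_mul_const, intervalIntegral.integral_mul_const, integral_cos,
    integral_sin, Real.sin_add_pi_div_two, Real.sin_sub_pi_div_two, Real.cos_add_pi_div_two,
    Real.cos_sub_pi_div_two]
  ring

/-- Lebesgue measure on the open half circle of directions centred at `φ`. -/
noncomputable def halfCircle (φ : ℝ) : Measure ℝ :=
  volume.restrict (Set.Ioo (φ - Real.pi / 2) (φ + Real.pi / 2))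

instance (φ : ℝ) : IsFiniteMeasure (halfCircle φ) := by
  rw [halfCircle]
  infer_instance

theorem halfCircle_univ (φ : ℝ) : (halfCircle φ).real Set.univ = Real.pi := by
  rw [halfCircle, measureReal_restrict_apply_univ, Real.volume_real_Ioo_of_le]
  · ring
  · linarith [Real.pi_pos]

/-- The perimeter of the hull exceeds twice the displacement in direction `φ` by the integral of the
excess over a half circle. -/
theorem perim_eq (Z : ℕ → Ω → Plane) (n : ℕ) (φ : ℝ) (ω : Ω) :
    perim Z n ω = 2 * inner ℝ (dir φ) (walk Z n ω) +
      ∫ θ, excess Z n (dir θ) ω ∂halfCircle φ := by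
  have hfin : ((fun j : ℕ => walk Z j ω) '' Set.Iic n).Finite := (Set.finite_Iic n).image _
  have hne : hfin.toFinset.Nonempty := by
    rw [Set.Finite.toFinset_nonempty]
    exact ⟨_, 0, n.zero_le, rfl⟩
  have h := perimeter_convexHull hne φ
  rw [hfin.coe_toFinset] at h
  change perim Z n ω = ∫ θ in (φ - Real.pi / 2)..(φ + Real.pi / 2),
    (volume ((fun x => (inner ℝ (dir θ) x : ℝ)) '' hull Z n ω)).toReal at h
  simp_rw [volume_inner_image_hull] at h
  rw [h, intervalIntegral.integral_add ((continuous_inner_dir _).intervalIntegrable _ _)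
    ((continuous_excess Z n ω).intervalIntegrable _ _), integral_inner_dir,
    intervalIntegral.integral_of_le (b := φ + Real.pi / 2) (by linarith [Real.pi_pos]),
    integral_Ioc_eq_integral_Ioo, halfCircle]

theorem lindley_le_sum_abs (X : ℕ → ℝ) (n : ℕ) : lindley X n ≤ ∑ i ∈ Finset.range n, |X i| := by
  induction n with
  | zero => simp [lindley]
  | succ n ih =>
    rw [Finset.sum_range_succ]
    refine max_le (add_le_add ih (le_abs_self _)) ?_
    exact add_nonneg (Finset.sum_nonneg fun _ _ => abs_nonneg _) (abs_nonneg _)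

theorem abs_inner_dir_le (θ : ℝ) (v : Plane) : |inner ℝ (dir θ) v| ≤ ‖v‖ := by
  simpa [norm_dir] using abs_real_inner_le_norm (dir θ) v

theorem excess_le (Z : ℕ → Ω → Plane) (n : ℕ) (θ : ℝ) (ω : Ω) :
    excess Z n (dir θ) ω ≤ 2 * ∑ i ∈ Finset.range n, ‖Z i ω‖ := by
  have h1 := lindley_le_sum_abs (fun i => -inner ℝ (dir θ) (Z i ω)) n
  have h2 := lindley_le_sum_abs (fun i => -inner ℝ (dir θ) (Z (revBelow n i) ω)) n
  have h3 : ∑ i ∈ Finset.range n, ‖Z (revBelow n i) ω‖ = ∑ i ∈ Finset.range n, ‖Z i ω‖ := by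
    have := sum_Ico_revBelow (fun i => ‖Z i ω‖) (le_refl n)
    rwa [Nat.sub_self, ← Finset.range_eq_Ico] at this
  simp only [abs_neg] at h1 h2
  have h4 : ∑ i ∈ Finset.range n, |(inner ℝ (dir θ) (Z i ω) : ℝ)| ≤
      ∑ i ∈ Finset.range n, ‖Z i ω‖ := Finset.sum_le_sum fun i _ => abs_inner_dir_le _ _
  have h5 : ∑ i ∈ Finset.range n, |(inner ℝ (dir θ) (Z (revBelow n i) ω) : ℝ)| ≤
      ∑ i ∈ Finset.range n, ‖Z (revBelow n i) ω‖ :=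
    Finset.sum_le_sum fun i _ => abs_inner_dir_le _ _
  rw [excess]
  linarith

/-- Cauchy–Schwarz against `1`, from the discriminant of the nonnegative quadratic `t ↦ ∫ (t - f)²`.
-/
theorem sq_integral_le_measure_mul_integral_sq {α : Type*} [MeasurableSpace α] {ν : Measure α}
    [IsFiniteMeasure ν] {f : α → ℝ} (hf : MemLp f 2 ν) :
    (∫ x, f x ∂ν) ^ 2 ≤ ν.real Set.univ * ∫ x, f x ^ 2 ∂ν := by
  have hI : Integrable f ν := hf.integrable (by norm_num)
  have h : ∀ t : ℝ, 0 ≤ ν.real Set.univ * (t * t) + (-2 * ∫ x, f x ∂ν) * t + ∫ x, f x ^ 2 ∂ν := by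
    intro t
    have h0 : 0 ≤ ∫ x, (t * t + ((-2 * t) * f x + f x ^ 2)) ∂ν :=
      integral_nonneg fun x => by
        change 0 ≤ t * t + ((-2 * t) * f x + f x ^ 2)
        nlinarith [sq_nonneg (t - f x)]
    rw [integral_add (g := fun x => (-2 * t) * f x + f x ^ 2) (integrable_const _)
      ((hI.const_mul _).add hf.integrable_sq),
      integral_add (hI.const_mul _) hf.integrable_sq, integral_const, smul_eq_mul,
      integral_const_mul] at h0
    linarith
  have := discrim_le_zero h
  rw [discrim] at this
  linarith

theorem sq_covariance_le {Ω : Type*} [MeasurableSpace Ω] {P : Measure Ω} [IsProbabilityMeasure P]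
    {X Y : Ω → ℝ} (hX : MemLp X 2 P) (hY : MemLp Y 2 P) :
    cov[X, Y; P] ^ 2 ≤ Var[X; P] * Var[Y; P] := by
  have h : ∀ t : ℝ, 0 ≤ Var[X; P] * (t * t) + (2 * cov[X, Y; P]) * t + Var[Y; P] := by
    intro t
    have h0 := variance_nonneg (t • X + Y) P
    rw [variance_add (hX.const_smul t) hY, variance_smul, covariance_smul_left] at h0
    linarith
  have := discrim_le_zero h
  rw [discrim] at this
  linarith

/-! ### Mean-square bounds for the integrated excess -/

section Walk

variable [MeasurableSpace Ω] {P : Measure Ω} {Z : ℕ → Ω → Plane}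

theorem measurable_excess (hZ : ∀ i, Measurable (Z i)) (n : ℕ) :
    Measurable fun a : Ω × ℝ => excess Z n (dir a.2) a.1 := by
  have key : ∀ i, Measurable fun a : Ω × ℝ => -(inner ℝ (dir a.2) (Z i a.1) : ℝ) := by
    intro i
    have hd : Continuous dir := by
      refine (PiLp.continuous_toLp 2 _).comp (continuous_pi fun i => ?_)
      fin_cases i
      · exact Real.continuous_cos
      · exact Real.continuous_sin
    exact ((hd.measurable.comp measurable_snd).inner ((hZ i).comp measurable_fst)).neg
  exact (measurable_lindley key n).add (measurable_lindley (fun i => key (revBelow n i)) n)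

theorem memLp_sum_norm (hZ2 : ∀ i, MemLp (Z i) 2 P) (n : ℕ) :
    MemLp (fun ω => 2 * ∑ i ∈ Finset.range n, ‖Z i ω‖) 2 P :=
  (memLp_finsetSum _ fun i _ => (hZ2 i).norm).const_mul 2

theorem memLp_excess [IsFiniteMeasure P] (hZ : ∀ i, Measurable (Z i))
    (hZ2 : ∀ i, MemLp (Z i) 2 P) (n : ℕ) (φ : ℝ) :
    MemLp (fun a : Ω × ℝ => excess Z n (dir a.2) a.1) 2 (P.prod (halfCircle φ)) := by
  refine MemLp.mono ((memLp_sum_norm hZ2 n).comp_fst (halfCircle φ))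
    (measurable_excess hZ n).aestronglyMeasurable (ae_of_all _ fun a => ?_)
  rw [Real.norm_of_nonneg (excess_nonneg _ _ _ _)]
  exact (excess_le Z n a.2 a.1).trans (le_abs_self _)

/-- Cauchy–Schwarz in the direction, then Fubini; `π` is the total mass of the half circle. -/
theorem memLp_integral_excess [IsFiniteMeasure P] (hZ : ∀ i, Measurable (Z i))
    (hZ2 : ∀ i, MemLp (Z i) 2 P) (n : ℕ) (φ : ℝ) :
    MemLp (fun ω => ∫ θ, excess Z n (dir θ) ω ∂halfCircle φ) 2 P ∧
    ∫ ω, (∫ θ, excess Z n (dir θ) ω ∂halfCircle φ) ^ 2 ∂P ≤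
      Real.pi * ∫ θ, (∫ ω, excess Z n (dir θ) ω ^ 2 ∂P) ∂halfCircle φ := by
  have hm : StronglyMeasurable (Function.uncurry fun ω θ => excess Z n (dir θ) ω) :=
    (measurable_excess hZ n).stronglyMeasurable
  have h2 := (memLp_excess hZ hZ2 n φ).integrable_sq
  have hmem : MemLp (fun ω => ∫ θ, excess Z n (dir θ) ω ∂halfCircle φ) 2 P := by
    refine ((memLp_sum_norm hZ2 n).const_mul Real.pi).mono
      hm.integral_prod_right.aestronglyMeasurable (ae_of_all _ fun ω => ?_)
    have := norm_integral_le_of_norm_le_const (μ := halfCircle φ)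
      (f := fun θ => excess Z n (dir θ) ω) (C := 2 * ∑ i ∈ Finset.range n, ‖Z i ω‖)
      (ae_of_all _ fun θ => by
        rw [Real.norm_of_nonneg (excess_nonneg _ _ _ _)]; exact excess_le Z n θ ω)
    rw [halfCircle_univ, mul_comm] at this
    exact this.trans (le_abs_self _)
  refine ⟨hmem, ?_⟩
  rw [← integral_integral_swap (f := fun ω θ => excess Z n (dir θ) ω ^ 2) h2, ← integral_const_mul]
  refine integral_mono hmem.integrable_sq (h2.integral_prod_left.const_mul _) fun ω => ?_
  have hθ : MemLp (fun θ => excess Z n (dir θ) ω) 2 (halfCircle φ) := by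
    refine MemLp.of_bound (continuous_excess Z n ω).aestronglyMeasurable
      (2 * ∑ i ∈ Finset.range n, ‖Z i ω‖) (ae_of_all _ fun θ => ?_)
    rw [Real.norm_of_nonneg (excess_nonneg _ _ _ _)]
    exact excess_le Z n θ ω
  have := sq_integral_le_measure_mul_integral_sq hθ
  rwa [halfCircle_univ] at this

end Walk

section IID

variable {Ω : Type*} [MeasurableSpace Ω] {P : Measure Ω} {Z : ℕ → Ω → Plane}

/-- Bounds for the forward and the reversed overshoot bound the excess. -/
theorem integral_excess_sq_le (hZ : ∀ i, Measurable (Z i)) (hZ2 : ∀ i, MemLp (Z i) 2 P)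
    (n : ℕ) (u : Plane) {C : ℝ}
    (h1 : ∫ ω, lindley (fun i => -inner ℝ u (Z i ω)) n ^ 2 ∂P ≤ C)
    (h2 : ∫ ω, lindley (fun i => -inner ℝ u (Z (revBelow n i) ω)) n ^ 2 ∂P ≤ C) :
    ∫ ω, excess Z n u ω ^ 2 ∂P ≤ 4 * C := by
  have key : ∀ Z' : ℕ → Ω → Plane, (∀ i, Measurable (Z' i)) → (∀ i, MemLp (Z' i) 2 P) →
      MemLp (fun ω => lindley (fun i => -inner ℝ u (Z' i ω)) n) 2 P := by
    intro Z' hZ' hZ2'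
    have hX : ∀ i, MemLp (fun ω => (-inner ℝ u (Z' i ω) : ℝ)) 2 P := fun i =>
      ((hZ2' i).const_inner u).neg
    have hsum : MemLp (fun ω => ∑ i ∈ Finset.range n, |(-inner ℝ u (Z' i ω) : ℝ)|) 2 P :=
      memLp_finsetSum (Finset.range n) fun i _ => (hX i).abs
    refine hsum.mono
      (measurable_lindley (fun i => (measurable_const.inner (hZ' i)).neg) n).aestronglyMeasurable
      (ae_of_all _ fun ω => ?_)
    rw [Real.norm_of_nonneg (lindley_nonneg _ _)]
    exact (lindley_le_sum_abs _ n).trans (le_abs_self _)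
  have m1 := key Z hZ hZ2
  have m2 := key (fun i => Z (revBelow n i)) (fun i => hZ _) fun i => hZ2 _
  have h := integral_mono (m1.add m2).integrable_sq
    ((m1.integrable_sq.const_mul 2).add (m2.integrable_sq.const_mul 2)) fun ω => by
      simp only [Pi.add_apply]
      exact add_sq_le.trans_eq (mul_add _ _ _)
  simp only [Pi.add_apply] at h
  rw [integral_add (m1.integrable_sq.const_mul 2) (m2.integrable_sq.const_mul 2),
    integral_const_mul, integral_const_mul] at h
  simp only [excess]
  linarith

theorem tendsto_integral_excess_sq [IsProbabilityMeasure P]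
    (hZ : ∀ i, Measurable (Z i)) (hind : iIndepFun Z P)
    (hid : ∀ i, IdentDistrib (Z i) (Z 0) P P) (hZ0 : MemLp (Z 0) 2 P)
    {u : Plane} (hu : 0 < inner ℝ u (∫ ω, Z 0 ω ∂P)) :
    Tendsto (fun n : ℕ => (n : ℝ)⁻¹ * ∫ ω, excess Z n u ω ^ 2 ∂P) atTop (𝓝 0) := by
  have hZ2 : ∀ i, MemLp (Z i) 2 P := fun i => (hid i).symm.memLp_iff.1 hZ0
  have hf : Measurable fun z : Plane => (-inner ℝ u z : ℝ) := by fun_prop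
  have hY2 : MemLp (fun ω => (-inner ℝ u (Z 0 ω) : ℝ)) 2 P := (hZ0.const_inner u).neg
  have hneg : ∫ ω, (-inner ℝ u (Z 0 ω) : ℝ) ∂P < 0 := by
    rw [integral_neg, integral_inner (hZ0.integrable (by norm_num))]
    linarith
  rw [Metric.tendsto_atTop]
  intro ε hε
  obtain ⟨C, hC⟩ := exists_integral_lindley_sq_le (hf.comp (hZ 0)) hY2 hneg
    (show 0 < ε / 8 by positivity)
  have hlim : Tendsto (fun n : ℕ => 4 * C * (n : ℝ)⁻¹) atTop (𝓝 0) := by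
    simpa using tendsto_inv_atTop_nhds_zero_nat.const_mul (4 * C)
  obtain ⟨N, hN⟩ := (hlim.eventually (gt_mem_nhds (half_pos hε))).exists_forall_of_atTop
  refine ⟨max N 1, fun n hn => ?_⟩
  have hn1 : 0 < (n : ℝ) := by exact_mod_cast (le_max_right N 1).trans hn
  have b1 := hC (fun i ω => -inner ℝ u (Z i ω)) (fun i => hf.comp (hZ i))
    (hind.comp (fun _ z => -inner ℝ u z) fun _ => hf) (fun i => (hid i).comp hf) n
  -- The permuted increments change with `n`, but they remain i.i.d. with the same marginal, so the
  -- uniform constant `C` still applies.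
  have b2 := hC (fun i ω => -inner ℝ u (Z (revBelow n i) ω)) (fun i => hf.comp (hZ _))
    ((hind.precomp (revBelow_injective n)).comp (fun _ z => -inner ℝ u z) fun _ => hf)
    (fun i => (hid _).comp hf) n
  have b := integral_excess_sq_le hZ hZ2 n u b1 b2
  have hpos : 0 ≤ ∫ ω, excess Z n u ω ^ 2 ∂P := integral_nonneg fun _ => sq_nonneg _
  rw [Real.dist_eq, sub_zero, abs_of_nonneg (by positivity)]
  calc (n : ℝ)⁻¹ * ∫ ω, excess Z n u ω ^ 2 ∂P ≤ (n : ℝ)⁻¹ * (4 * (C + ε / 8 * n)) := by gcongr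
    _ = 4 * C * (n : ℝ)⁻¹ + ε / 2 := by field_simp; ring
    _ < ε := by linarith [hN n ((le_max_left N 1).trans hn)]

/-- Supplies the dominating function over directions: after division by `n` the bound depends on
neither `θ` nor `n`. -/
theorem integral_excess_dir_sq_le [IsProbabilityMeasure P]
    (hZ : ∀ i, Measurable (Z i)) (hind : iIndepFun Z P)
    (hid : ∀ i, IdentDistrib (Z i) (Z 0) P P) (hZ0 : MemLp (Z 0) 2 P)
    {θ : ℝ} (hθ : 0 ≤ inner ℝ (dir θ) (∫ ω, Z 0 ω ∂P)) (n : ℕ) :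
    ∫ ω, excess Z n (dir θ) ω ^ 2 ∂P ≤ 4 * (n * ∫ ω, ‖Z 0 ω‖ ^ 2 ∂P) := by
  have hZ2 : ∀ i, MemLp (Z i) 2 P := fun i => (hid i).symm.memLp_iff.1 hZ0
  have hf : Measurable fun z : Plane => (-inner ℝ (dir θ) z : ℝ) := by fun_prop
  have hY2 : MemLp (fun ω => (-inner ℝ (dir θ) (Z 0 ω) : ℝ)) 2 P := (hZ0.const_inner _).neg
  have hneg : ∫ ω, (-inner ℝ (dir θ) (Z 0 ω) : ℝ) ∂P ≤ 0 := by
    rw [integral_neg, integral_inner (hZ0.integrable (by norm_num))]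
    linarith
  have hle : (n : ℝ) * ∫ ω, (-inner ℝ (dir θ) (Z 0 ω) : ℝ) ^ 2 ∂P ≤
      n * ∫ ω, ‖Z 0 ω‖ ^ 2 ∂P := by
    refine mul_le_mul_of_nonneg_left (integral_mono hY2.integrable_sq
      hZ0.norm.integrable_sq fun ω => ?_) n.cast_nonneg
    dsimp only
    rw [neg_sq, ← sq_abs]
    exact pow_le_pow_left₀ (abs_nonneg _) (abs_inner_dir_le _ _) 2
  refine integral_excess_sq_le hZ hZ2 n _ ((integral_lindley_sq_le (fun i => hf.comp (hZ i))
    (hind.comp (fun _ z => -inner ℝ (dir θ) z) fun _ => hf) (fun i => (hid i).comp hf) hY2 hneg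
    n).2.trans hle) ((integral_lindley_sq_le (fun i => hf.comp (hZ _))
    ((hind.precomp (revBelow_injective n)).comp (fun _ z => -inner ℝ (dir θ) z) fun _ => hf)
    (fun i => (hid _).comp hf) hY2 hneg n).2.trans hle)

/-- The perimeter is approximated in mean square by twice the displacement in the direction of the
drift. -/
theorem tendsto_integral_sq_integral_excess [IsProbabilityMeasure P]
    (hZ : ∀ i, Measurable (Z i)) (hind : iIndepFun Z P)
    (hid : ∀ i, IdentDistrib (Z i) (Z 0) P P) (hZ0 : MemLp (Z 0) 2 P)
    {φ r : ℝ} (hr : 0 < r)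
    (hφ : ∫ ω, Z 0 ω ∂P = r • dir φ) :
    Tendsto (fun n : ℕ => (n : ℝ)⁻¹ *
      ∫ ω, (∫ θ, excess Z n (dir θ) ω ∂halfCircle φ) ^ 2 ∂P) atTop (𝓝 0) := by
  have hZ2 : ∀ i, MemLp (Z i) 2 P := fun i => (hid i).symm.memLp_iff.1 hZ0
  -- The half circle is open, so the cosine, and with it the drift in direction `θ`, is strictly
  -- positive.
  have hdrift : ∀ᵐ θ ∂halfCircle φ, 0 < inner ℝ (dir θ) (∫ ω, Z 0 ω ∂P) := by
    refine (ae_restrict_mem measurableSet_Ioo).mono fun θ hθ => ?_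
    rw [hφ, inner_dir_smul_dir]
    exact mul_pos hr (Real.cos_pos_of_mem_Ioo ⟨by linarith [hθ.1], by linarith [hθ.2]⟩)
  have hlim : Tendsto (fun n : ℕ => ∫ θ, (n : ℝ)⁻¹ * ∫ ω, excess Z n (dir θ) ω ^ 2 ∂P
      ∂halfCircle φ) atTop (𝓝 (∫ _, (0 : ℝ) ∂halfCircle φ)) := by
    refine tendsto_integral_of_dominated_convergence (fun _ => 4 * ∫ ω, ‖Z 0 ω‖ ^ 2 ∂P)
      (fun n => ?_) (integrable_const _) (fun n => ?_) ?_
    · exact (memLp_excess hZ hZ2 n φ).integrable_sq.integral_prod_right.aestronglyMeasurable.const_mul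
        _
    · filter_upwards [hdrift] with θ hθ
      have hpos : 0 ≤ ∫ ω, excess Z n (dir θ) ω ^ 2 ∂P := integral_nonneg fun _ => sq_nonneg _
      rw [Real.norm_of_nonneg (by positivity)]
      rcases n.eq_zero_or_pos with rfl | hn
      · simp only [Nat.cast_zero, inv_zero, zero_mul]
        exact mul_nonneg (by norm_num) (integral_nonneg fun _ => sq_nonneg _)
      · have hn' : (0 : ℝ) < n := by exact_mod_cast hn
        rw [inv_mul_le_iff₀ hn']
        exact (integral_excess_dir_sq_le hZ hind hid hZ0 hθ.le n).trans_eq (by ring)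
    · filter_upwards [hdrift] with θ hθ
      exact tendsto_integral_excess_sq hZ hind hid hZ0 hθ
  rw [integral_zero] at hlim
  have hlim' := hlim.const_mul Real.pi
  rw [mul_zero] at hlim'
  refine squeeze_zero (fun n => ?_) (fun n => ?_) hlim'
  · exact mul_nonneg (by positivity) (integral_nonneg fun _ => sq_nonneg _)
  · rw [integral_const_mul, mul_left_comm]
    exact mul_le_mul_of_nonneg_left (memLp_integral_excess hZ hZ2 n φ).2 (by positivity)

end IID

/-! ### The limiting variance and the main theorem -/

theorem driftComponent_eq {Ω : Type*} [MeasurableSpace Ω] {P : Measure Ω} [IsProbabilityMeasure P]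
    {X : Ω → Plane} (hX : Integrable X P) {φ r : ℝ} (hφ : ∫ ω, X ω ∂P = r • dir φ) (ω : Ω) :
    driftComponent P X ω =
      r * (inner ℝ (dir φ) (X ω) - ∫ ω, (inner ℝ (dir φ) (X ω) : ℝ) ∂P) := by
  have h : ∀ v : Plane, inner ℝ v (∫ ω, X ω ∂P) = r * inner ℝ (dir φ) v := fun v => by
    rw [hφ, inner_smul_right, real_inner_comm]
  rw [integral_inner hX, driftComponent, h, inner_sub_right]

theorem sigmaSq_eq {Ω : Type*} [MeasurableSpace Ω] {P : Measure Ω} [IsProbabilityMeasure P]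
    {X : Ω → Plane} (hX : MemLp X 2 P) {φ r : ℝ} (hr : 0 < r) (hφ : ∫ ω, X ω ∂P = r • dir φ) :
    sigmaSq P X = 4 * Var[fun ω => (inner ℝ (dir φ) (X ω) : ℝ); P] := by
  have hI := hX.integrable (by norm_num)
  rw [sigmaSq, variance_eq_integral (hX.const_inner _).aemeasurable]
  simp_rw [driftComponent_eq hI hφ, mul_pow]
  rw [integral_const_mul, hφ, norm_smul, norm_dir, mul_one, Real.norm_of_nonneg hr.le]
  field_simp

end PlanarWalk

open PlanarWalk in
theorem theorem1p1 {Ω : Type*} [MeasurableSpace Ω] (P : Measure Ω) [IsProbabilityMeasure P]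
    (Z : ℕ → Ω → PlanarWalk.Plane)
    (hmeas : ∀ i, Measurable (Z i))
    (hindep : iIndepFun Z P)
    (hident : ∀ i, IdentDistrib (Z i) (Z 0) P P)
    (hsq : Integrable (fun ω => ‖Z 0 ω‖ ^ 2) P)
    (hmean : (∫ ω, Z 0 ω ∂P) ≠ 0) :
    -- the variances and the expectation in the limit are finite
    (∀ n, MemLp (PlanarWalk.perim Z n) 2 P) ∧
    Integrable (fun ω => PlanarWalk.driftComponent P (Z 0) ω ^ 2) P ∧
    0 ≤ PlanarWalk.sigmaSq P (Z 0) ∧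
    -- the variance asymptotics
    Tendsto (fun n : ℕ => (n : ℝ)⁻¹ * variance (PlanarWalk.perim Z n) P) atTop
      (𝓝 (PlanarWalk.sigmaSq P (Z 0))) ∧
    -- the degenerate case
    (PlanarWalk.sigmaSq P (Z 0) = 0 ↔ ∀ᵐ ω ∂P, PlanarWalk.driftComponent P (Z 0) ω = 0) := by
  have hZ0 : MemLp (Z 0) 2 P :=
    (memLp_two_iff_integrable_sq_norm (hmeas 0).aestronglyMeasurable).2 hsq
  have hZ2 : ∀ i, MemLp (Z i) 2 P := fun i => (hident i).symm.memLp_iff.1 hZ0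
  have hI := hZ0.integrable (by norm_num)
  obtain ⟨φ, hφ⟩ := exists_eq_norm_smul_dir (∫ ω, Z 0 ω ∂P)
  have hr : 0 < ‖∫ ω, Z 0 ω ∂P‖ := norm_pos_iff.2 hmean
  have hσ := sigmaSq_eq hZ0 hr hφ
  set X : ℕ → Ω → ℝ := fun i ω => inner ℝ (dir φ) (Z i ω) with hX
  have hXm : ∀ i, MemLp (X i) 2 P := fun i => (hZ2 i).const_inner _
  have hf : Measurable fun z : Plane => (inner ℝ (dir φ) z : ℝ) := by fun_prop
  have hXid : ∀ i, IdentDistrib (X i) (X 0) P P := fun i => (hident i).comp hf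
  have hXind : iIndepFun X P := hindep.comp (fun _ z => inner ℝ (dir φ) z) fun _ => hf
  set Y : ℕ → Ω → ℝ := fun n => ∑ i ∈ Finset.range n, (2 : ℝ) • X i with hY
  set D : ℕ → Ω → ℝ := fun n ω => ∫ θ, excess Z n (dir θ) ω ∂halfCircle φ with hD
  have hdecomp : ∀ n, perim Z n = Y n + D n := by
    intro n
    funext ω
    rw [perim_eq Z n φ ω, inner_walk, Finset.mul_sum]
    simp [hY, hX, hD]
  have hYm : ∀ n, MemLp (Y n) 2 P := fun n => memLp_finsetSum' _ fun i _ => (hXm i).const_smul 2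
  have hDm : ∀ n, MemLp (D n) 2 P := fun n => (memLp_integral_excess hmeas hZ2 n φ).1
  -- The factor `4` in `σ²` is the square of the `2` in `2 e·Sₙ`.
  have hYvar : ∀ n : ℕ, Var[Y n; P] = n * sigmaSq P (Z 0) := by
    intro n
    rw [hY, IndepFun.variance_sum (fun i _ => (hXm i).const_smul 2)
      (fun i _ j _ hij => (hXind.indepFun hij).comp (measurable_const_smul (2 : ℝ))
        (measurable_const_smul (2 : ℝ)))]
    simp_rw [variance_smul, fun i => (hXid i).variance_eq]
    rw [Finset.sum_const, Finset.card_range, nsmul_eq_mul, hσ]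
    ring
  have hDvar : Tendsto (fun n : ℕ => (n : ℝ)⁻¹ * Var[D n; P]) atTop (𝓝 0) := by
    refine squeeze_zero (fun n => mul_nonneg (by positivity) (variance_nonneg _ _)) (fun n => ?_)
      (tendsto_integral_sq_integral_excess hmeas hindep hident hZ0 hr hφ)
    exact mul_le_mul_of_nonneg_left (variance_le_expectation_sq (hDm n).1) (by positivity)
  have hσ0 : 0 ≤ sigmaSq P (Z 0) := by
    rw [hσ]
    exact mul_nonneg (by norm_num) (variance_nonneg _ _)
  -- Cauchy–Schwarz and `Var[Y n] = n σ²` give `(cov / n)² ≤ σ² · Var[D n] / n`, which tends to `0`.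
  have hcov : Tendsto (fun n : ℕ => (n : ℝ)⁻¹ * cov[Y n, D n; P]) atTop (𝓝 0) := by
    have hsqrt : Tendsto (fun n : ℕ => √(sigmaSq P (Z 0) * ((n : ℝ)⁻¹ * Var[D n; P])))
        atTop (𝓝 0) := by
      simpa using (hDvar.const_mul (sigmaSq P (Z 0))).sqrt
    refine squeeze_zero_norm (fun n => ?_) hsqrt
    rw [Real.norm_eq_abs]
    refine Real.abs_le_sqrt ?_
    rcases n.eq_zero_or_pos with rfl | hn
    · simp
    · have hn' : (0 : ℝ) < n := by exact_mod_cast hn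
      calc ((n : ℝ)⁻¹ * cov[Y n, D n; P]) ^ 2 = ((n : ℝ)⁻¹) ^ 2 * cov[Y n, D n; P] ^ 2 := by ring
        _ ≤ ((n : ℝ)⁻¹) ^ 2 * (Var[Y n; P] * Var[D n; P]) := by
          gcongr
          exact sq_covariance_le (hYm n) (hDm n)
        _ = _ := by
          rw [hYvar]
          field_simp
  have hdrift : Integrable (fun ω => driftComponent P (Z 0) ω ^ 2) P := by
    simp_rw [driftComponent_eq hI hφ]
    exact (((hXm 0).sub (memLp_const _)).const_mul _).integrable_sq
  refine ⟨fun n => ?_, hdrift, hσ0, ?_, ?_⟩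
  · rw [hdecomp]
    exact (hYm n).add (hDm n)
  · have hmain : Tendsto (fun n : ℕ => sigmaSq P (Z 0) + 2 * ((n : ℝ)⁻¹ * cov[Y n, D n; P]) +
        (n : ℝ)⁻¹ * Var[D n; P]) atTop (𝓝 (sigmaSq P (Z 0))) := by
      simpa using (tendsto_const_nhds.add (hcov.const_mul 2)).add hDvar
    refine hmain.congr' ?_
    filter_upwards [eventually_gt_atTop 0] with n hn
    have hn' : (0 : ℝ) < n := by exact_mod_cast hn
    rw [hdecomp, variance_add (hYm n) (hDm n), hYvar]
    field_simp
  · rw [sigmaSq, div_eq_zero_iff, or_iff_left (pow_ne_zero 2 hr.ne'), mul_eq_zero,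
      or_iff_right (by norm_num), integral_eq_zero_iff_of_nonneg (fun _ => sq_nonneg _) hdrift]
    exact eventually_congr (ae_of_all _ fun ω => pow_eq_zero_iff two_ne_zero)
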